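/- For $N\ge 1$ let $P_N$ be the joint law of the eigenvalues of the complex Ginibre ensemble ($N\times N$ matrices with independent complex Gaussian entries of mean $0$ and variance $1/N$), that is, the probability measure $$dP_N(z_1,\dots,z_N)=\frac1{Z_N}\prod_{1\le l<k\le N}|z_l-z_k|^2\prod_{k=1}^N e^{-N|z_k|^2}\,d\Re(z_k)\,d\Im(z_k)$$ on $\mathbb C^N$, with $Z_N$ the normalizing constant. For $-\pi\le a\le b\le\pi$ let $\#\Theta[a,b]$ be the number of $k$ with $\arg z_k\in[a,b]$ (angles in radians, $\arg z\in(-\pi,\pi]$), and let $\mathrm{Var}_N$ be the variance under $P_N$. For $\beta>0$ put $$I_{arg}(\beta)=\int_0^1\frac{1-e^{-\beta^2x}}{2\sqrt x}\,dx+\beta\int_0^1\int_{\beta\sqrt x}^\infty e^{-\theta^2}\,d\theta\,dx .$$ By rotation invariance, $\mathrm{Var}_N(\#\Theta[a,b])=\mathrm{Var}_N\bigl(\#\Theta[-\tfrac{b-a}2,\tfrac{b-a}2]\bigr)$. If $\alpha\in(0,2\pi)$ is fixed and $N\to\infty$, then $$\mathrm{Var}_N\bigl(\#\Theta[-\tfrac\alpha2,\tfrac\alpha2]\bigr)=\frac{\sqrt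 N}{\pi^{3/2}}+O(\log N).$$ If $\alpha=\alpha(N)>0$ satisfies $\alpha(N)\to0$ and $N\alpha(N)\to\infty$, then $V_N:=\mathrm{Var}_N\bigl(\#\Theta[-\tfrac{\alpha(N)}2,\tfrac{\alpha(N)}2]\bigr)$ satisfies: 1. if $\sqrt N\alpha(N)\to\infty$, then $V_N=\frac{\sqrt N}{\pi^{3/2}}(1+o(1))$; 2. if $\sqrt N\alpha(N)\to\beta>0$, then $V_N=\frac{\sqrt N}{\pi^{3/2}}I_{arg}\bigl(\sqrt N\alpha(N)\bigr)+O(\log N)$ and $V_N=\frac{\sqrt N}{\pi^{3/2}}I_{arg}(\beta)(1+o(1))$; if moreover $\sqrt N\alpha(N)-\beta=O(\log N/\sqrt N)$, in particular if $\alpha(N)=\beta/\sqrt N$, then $V_N=\frac{\sqrt N}{\pi^{3/2}}I_{arg}(\beta)+O(\log N)$; 3. if $\sqrt N\alpha(N)\to0$, then $V_N=\frac{N\alpha(N)}{2\pi}(1+o(1))$. Moreover $I_{arg}(\beta)\ge0$ for $\beta>0$, $\lim_{\beta\downarrow0}I_{arg}(\beta)=0$ and $\lim_{\beta\uparrow\infty}I_{arg}(\beta)=1$.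 -/

import Mathlib

open MeasureTheory ProbabilityTheory Filter Topology Asymptotics Set

namespace Ginibre

noncomputable section

/-- The weight `μ_N(dz) = e^{-N|z|²} dRe(z) dIm(z)` on the complex plane. -/
def weight (N : ℕ) : Measure ℂ :=
  (volume : Measure ℂ).withDensity fun z => ENNReal.ofReal (Real.exp (-(N : ℝ) * ‖z‖ ^ 2))

/-- The squared modulus of the Vandermonde product, `∏_{l < k} |z_l - z_k|²`. -/
def vandermondeSq {N : ℕ} (z : Fin N → ℂ) : ℝ :=
  ∏ k : Fin N, ∏ l ∈ Finset.Iio k, ‖z l - z k‖ ^ 2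

/-- The unnormalized joint eigenvalue law
`∏_{l < k} |z_l - z_k|² μ_N(dz_1) ⋯ μ_N(dz_N)` on `ℂ^N`. -/
def unnormalizedLaw (N : ℕ) : Measure (Fin N → ℂ) :=
  (Measure.pi fun _ : Fin N => weight N).withDensity fun z => ENNReal.ofReal (vandermondeSq z)

/-- The normalizing constant `Z_N`. -/
def partitionFunction (N : ℕ) : ENNReal := unnormalizedLaw N univ

/-- The joint law `P_N` of the eigenvalues of the complex Ginibre ensemble. -/
def eigenvalueLaw (N : ℕ) : Measure (Fin N → ℂ) :=
  (partitionFunction N)⁻¹ • unnormalizedLaw N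

/-- The linear statistic `X(f) = ∑_k f(z_k)`. -/
def linearStatistic {N : ℕ} (f : ℂ → ℝ) (z : Fin N → ℂ) : ℝ := ∑ k, f (z k)

/-- The number of points among `z_1, …, z_N` whose argument lies in `[a, b]`. -/
def angularNumber {N : ℕ} (a b : ℝ) : (Fin N → ℂ) → ℝ :=
  linearStatistic ({w : ℂ | w.arg ∈ Icc a b}.indicator fun _ => (1 : ℝ))

/-- The variance under `P_N` of the number of points with argument in `[a, b]`. -/
def angularVariance (N : ℕ) (a b : ℝ) : ℝ :=
  variance (angularNumber a b) (eigenvalueLaw N)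

/-- The function
`I_arg(β) = ∫₀¹ (1 - e^{-β² x}) / (2 √x) dx + β ∫₀¹ ∫_{β √x}^∞ e^{-θ²} dθ dx`. -/
def Iarg (β : ℝ) : ℝ :=
  (∫ x in (0 : ℝ)..1, (1 - Real.exp (-β ^ 2 * x)) / (2 * √x)) +
    β * ∫ x in (0 : ℝ)..1, ∫ θ in Ioi (β * √x), Real.exp (-θ ^ 2)

end

end Ginibre

/-!
The eigenvalues form a determinantal process. Expanding the squared Vandermonde product
(`integral_det_mul_det`), the generating function `E (1 + t)^X` of the number `X` of eigenvalues with
argument in an arc of length `L` is `det (1 + t F)`, where `F` is the Gram matrix over the sector of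
the orthonormalized monomials `z^j`. Hence `Var X = tr F - tr F²`. In polar coordinates `|F_{ij}|²` is
the squared `(i - j)`-th Fourier coefficient of the arc times `Γ((i+j)/2+1)² / (i! j!)`
(`angularVariance_eq_sum`), which shows rotation invariance.

Parseval's identity for the arc (`hasSum_arcWeight`) turns `tr F` into a sum over all Fourier modes,
so that `Var X` is a sum over `j < N` of `2 ∑_m s(m) (1 - γ(j, j+m))` with
`s(m) = (1 - cos mL) / (2π²m²)`, up to `O(log N)` from the modes with `j + m ≥ N`. The gamma
ratio `γ(j, j+m)` is `e^{-m²/(4(j+1))}` with an error that costs `O(1/(j+1))` in each row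
(`abs_gammaRatio_sub_exp_le`), again `O(log N)` in total. The Gaussian row is a time integral of
the difference of the heat kernel of the circle at distances `0` and `L`. Poisson summation gives
its short-time asymptotics (`abs_heatDiff_sub_le`), and the row with `J = j + 1` becomes
`π^{-3/2} g(L, J) + O(1/J)`, where `g` (`crossover`) is exactly the integrand of `Iarg`. Since `g`
decreases in `J` and scales, `∑_{J ≤ N} g(L, J) = √N Iarg(√N L) + O(1)`. This yields

`Var X = √N π^{-3/2} Iarg(√N L) + O(log N)`,

uniformly for `L` bounded away from `2π` (`abs_angularVariance_sub_Iarg_le`). The regimes follow from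
`|Iarg β - 1| ≤ 1/β` and from the Lipschitz continuity of `Iarg`, except for `√N L → 0`, where the
logarithm may exceed the main term; there `tr F² ≪ tr F = N L / (2π)` follows directly from the exact
formula (`abs_angularVariance_sub_mean_le`).
-/

/-! ### Andréief's identity and generating functions of counts -/

/-- Andréief's identity: the integral over `αⁿ` of a product of two determinants is, up to `n!`,
the determinant of the pairwise integrals. -/
theorem integral_det_mul_det {n α : Type*} [Fintype n] [DecidableEq n] [MeasurableSpace α]
    (μ : Measure α) [SigmaFinite μ] (f g : n → α → ℂ)
    (h : ∀ i j, Integrable (fun x => f i x * g j x) μ) :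
    ∫ x : n → α, (Matrix.of fun k i => f i (x k)).det * (Matrix.of fun k j => g j (x k)).det
        ∂(Measure.pi fun _ => μ) =
      (Fintype.card n).factorial * (Matrix.of fun i j => ∫ x, f i x * g j x ∂μ).det := by
  have key : ∀ x : n → α,
      (Matrix.of fun k i => f i (x k)).det * (Matrix.of fun k j => g j (x k)).det =
      ∑ σ : Equiv.Perm n, ∑ τ : Equiv.Perm n,
        (((σ.sign : ℤ) : ℂ) * ((τ.sign : ℤ) : ℂ)) * ∏ k, (f (σ k) (x k) * g (τ k) (x k)) := by
    intro x
    rw [← Matrix.det_transpose, Matrix.det_apply', ← Matrix.det_transpose (Matrix.of _),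
      Matrix.det_apply', Finset.sum_mul_sum]
    refine Finset.sum_congr rfl fun σ _ => Finset.sum_congr rfl fun τ _ => ?_
    simp only [Matrix.transpose_apply, Matrix.of_apply, Finset.prod_mul_distrib]
    ring
  have hint : ∀ σ τ : Equiv.Perm n, Integrable
      (fun x : n → α => ∏ k, (f (σ k) (x k) * g (τ k) (x k))) (Measure.pi fun _ => μ) :=
    fun σ τ => Integrable.fintype_prod (f := fun k y => f (σ k) y * g (τ k) y)
      fun k => h (σ k) (τ k)
  simp_rw [key]
  rw [integral_finsetSum _ fun σ _ => integrable_finsetSum _ fun τ _ =>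
    (hint σ τ).const_mul _]
  have inner : ∀ σ : Equiv.Perm n, ∫ x : n → α, ∑ τ : Equiv.Perm n,
        (((σ.sign : ℤ) : ℂ) * ((τ.sign : ℤ) : ℂ)) * ∏ k, (f (σ k) (x k) * g (τ k) (x k))
        ∂(Measure.pi fun _ => μ) = (Matrix.of fun i j => ∫ x, f i x * g j x ∂μ).det := by
    intro σ
    rw [integral_finsetSum _ fun τ _ => (hint σ τ).const_mul _]
    have h1 : ∀ τ : Equiv.Perm n, ∫ x : n → α,
        (((σ.sign : ℤ) : ℂ) * ((τ.sign : ℤ) : ℂ)) * ∏ k, (f (σ k) (x k) * g (τ k) (x k))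
        ∂(Measure.pi fun _ => μ) = ((σ.sign : ℤ) : ℂ) * (((τ.sign : ℤ) : ℂ) *
          ∏ k, (Matrix.of fun i j => ∫ x, f i x * g j x ∂μ).transpose (τ k) (σ k)) := by
      intro τ
      rw [integral_const_mul,
        integral_fintype_prod_eq_prod (fun k y => f (σ k) y * g (τ k) y), mul_assoc]
      rfl
    simp_rw [h1]
    rw [← Finset.mul_sum, ← Matrix.det_transpose]
    -- the inner sum is the determinant of the matrix with columns permuted by `σ`
    have h2 := Matrix.det_permute' σ (Matrix.of fun i j => ∫ x, f i x * g j x ∂μ).transpose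
    rw [Matrix.det_apply'] at h2
    simp only [Matrix.submatrix_apply, id_eq] at h2
    rw [h2, ← mul_assoc, ← Int.cast_mul, ← Units.val_mul, Int.units_mul_self]
    simp
  simp_rw [inner]
  simp [Fintype.card_perm]

open Polynomial in
/-- The Taylor coefficients of order at most two at `0` of `∏ (1 + c_i X)`. -/
theorem taylor_prod_one_add {ι : Type*} (s : Finset ι) (c : ι → ℝ) :
    (∏ i ∈ s, (1 + C (c i) * X)).eval 0 = 1 ∧
    (derivative (∏ i ∈ s, (1 + C (c i) * X))).eval 0 = ∑ i ∈ s, c i ∧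
    (derivative (derivative (∏ i ∈ s, (1 + C (c i) * X)))).eval 0 =
      (∑ i ∈ s, c i) ^ 2 - ∑ i ∈ s, c i ^ 2 := by
  classical
  induction s using Finset.induction_on with
  | empty => simp
  | insert a s ha ih =>
    obtain ⟨h0, h1, h2⟩ := ih
    rw [Finset.prod_insert ha, Finset.sum_insert ha, Finset.sum_insert ha]
    refine ⟨by simp [h0], ?_, ?_⟩
    · simp [derivative_mul, h0, h1]
    · simp [derivative_mul, h1, h2]
      ring

open Polynomial in
/-- A bounded count whose generating function `E (1 + t)^Y` is `∏ (1 + c_i t)` has the variance of a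
sum of independent Bernoulli variables with parameters `c_i`. -/
theorem variance_of_generating_function {Ω ι : Type*} [MeasurableSpace Ω] [Fintype ι]
    (P : Measure Ω) [IsProbabilityMeasure P] (Y : Ω → ℕ) (hY : Measurable Y) (N : ℕ)
    (hN : ∀ ω, Y ω ≤ N) (c : ι → ℝ)
    (h : ∀ t : ℝ, ∫ ω, (1 + t) ^ Y ω ∂P = ∏ i, (1 + c i * t)) :
    variance (fun ω => (Y ω : ℝ)) P = ∑ i, c i - ∑ i, c i ^ 2 := by
  set q : ℕ → ℝ := fun n => P.real (Y ⁻¹' {n}) with hq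
  have expand : ∀ g : ℕ → ℝ, ∫ ω, g (Y ω) ∂P = ∑ n ∈ Finset.range (N + 1), q n * g n := by
    intro g
    have : ∀ ω, g (Y ω) = ∑ n ∈ Finset.range (N + 1), (Y ⁻¹' {n}).indicator (fun _ => g n) ω := by
      intro ω
      rw [Finset.sum_eq_single_of_mem (Y ω) (by simpa [Nat.lt_succ_iff] using hN ω)]
      · simp
      · intro b _ hb
        simp [Set.indicator, hb.symm]
    simp_rw [this]
    rw [integral_finsetSum]
    · refine Finset.sum_congr rfl fun n _ => ?_
      rw [integral_indicator_const _ (hY (measurableSet_singleton n))]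
      simp [hq]
    · intro n _
      exact (integrable_const _).indicator (hY (measurableSet_singleton n))
  have hpoly : ∑ n ∈ Finset.range (N + 1), C (q n) * (1 + X) ^ n = ∏ i, (1 + C (c i) * X) := by
    refine Polynomial.funext fun t => ?_
    have := (expand fun n => (1 + t) ^ n).symm.trans (h t)
    simpa [eval_finsetSum, eval_prod] using this
  obtain ⟨-, h1, h2⟩ := taylor_prod_one_add Finset.univ c
  rw [← hpoly] at h1 h2
  have e1 : ∫ ω, (Y ω : ℝ) ∂P = ∑ i, c i := by
    rw [expand fun n => (n : ℝ), ← h1]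
    simp [eval_finsetSum, derivative_pow]
  have e2 : ∫ ω, (Y ω : ℝ) ^ 2 ∂P = (∑ i, c i) ^ 2 - ∑ i, c i ^ 2 + ∑ i, c i := by
    rw [expand fun n => (n : ℝ) ^ 2, ← h2, ← h1]
    simp only [derivative_sum, eval_finsetSum, ← Finset.sum_add_distrib]
    refine Finset.sum_congr rfl fun n _ => ?_
    rcases n with _ | n
    · simp
    · simp [derivative_pow]
      ring
  have hm : MemLp (fun ω => (Y ω : ℝ)) 2 P := by
    refine MemLp.of_bound ((measurable_from_nat (f := fun n : ℕ => (n : ℝ))).comp hY).aestronglyMeasurable N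
      (.of_forall fun ω => ?_)
    simpa using hN ω
  rw [variance_eq_sub hm]
  simp only [Pi.pow_apply]
  rw [e1, e2]
  ring

theorem Matrix.IsHermitian.det_one_add_smul_eq_prod {n : Type*} [Fintype n] [DecidableEq n]
    {F : Matrix n n ℂ} (hF : F.IsHermitian) (t : ℝ) :
    (1 + (t : ℂ) • F).det = ((∏ i, (1 + hF.eigenvalues i * t) : ℝ) : ℂ) := by
  have hs := hF.spectral_theorem
  rw [Unitary.conjStarAlgAut_apply] at hs
  set U := (hF.eigenvectorUnitary : Matrix n n ℂ) with hU
  have hUU : U * star U = 1 := by simp [hU]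
  have hUU' : star U * U = 1 := by simp [hU]
  have : 1 + (t : ℂ) • F = U * (1 + (t : ℂ) • Matrix.diagonal (RCLike.ofReal ∘ hF.eigenvalues)) * star U := by
    rw [Matrix.mul_add, Matrix.add_mul, Matrix.mul_one, hUU, Matrix.mul_smul, Matrix.smul_mul]
    congr 2
  rw [this, Matrix.det_mul_comm, ← mul_assoc, hUU', one_mul, ← Matrix.diagonal_one,
    ← Matrix.diagonal_smul, Matrix.diagonal_add, Matrix.det_diagonal]
  push_cast
  refine Finset.prod_congr rfl fun i _ => ?_
  simp [mul_comm]

theorem Matrix.IsHermitian.sum_eigenvalues_sq {n : Type*} [Fintype n] [DecidableEq n]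
    {F : Matrix n n ℂ} (hF : F.IsHermitian) :
    ∑ i, hF.eigenvalues i ^ 2 = ∑ i, ∑ j, ‖F i j‖ ^ 2 := by
  have hs := hF.spectral_theorem
  rw [Unitary.conjStarAlgAut_apply] at hs
  set U := (hF.eigenvectorUnitary : Matrix n n ℂ) with hU
  have hUU' : star U * U = 1 := by simp [hU]
  have h1 : (F * F).trace = ∑ i, ((hF.eigenvalues i : ℂ)) ^ 2 := by
    set D : Matrix n n ℂ := Matrix.diagonal (RCLike.ofReal ∘ hF.eigenvalues) with hD
    have : F * F = U * (D * D) * star U := by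
      conv_lhs => rw [hs]
      calc U * D * star U * (U * D * star U) = U * D * (star U * U) * D * star U := by
            simp only [mul_assoc]
        _ = _ := by rw [hUU', mul_one]; simp only [mul_assoc]
    rw [this, Matrix.trace_mul_comm, ← mul_assoc, hUU', one_mul, hD, Matrix.diagonal_mul_diagonal,
      Matrix.trace_diagonal]
    simp [sq]
  have h2 : (F * F).trace = ∑ i, ∑ j, ((‖F i j‖ ^ 2 : ℝ) : ℂ) := by
    simp only [Matrix.trace, Matrix.diag_apply, Matrix.mul_apply]
    refine Finset.sum_congr rfl fun i _ => Finset.sum_congr rfl fun j _ => ?_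
    rw [← hF.apply j i]
    push_cast
    exact Complex.mul_conj' _
  rw [h1] at h2
  exact_mod_cast h2

/-! ### Gram matrices of monomials over sectors -/

namespace Ginibre

/-- The sector of points of the complex plane with argument in `[a, b]`. -/
def sector (a b : ℝ) : Set ℂ := {w : ℂ | w.arg ∈ Icc a b}

theorem measurableSet_sector (a b : ℝ) : MeasurableSet (sector a b) :=
  Complex.measurable_arg measurableSet_Icc

/-- The radial moment `∫₀^∞ r^(n+1) e^{-N r²} dr`. -/
noncomputable def radialMoment (N n : ℕ) : ℝ :=
  ∫ r in Ioi (0 : ℝ), r ^ (n + 1) * Real.exp (-N * r ^ 2)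

/-- The (unnormalized) `m`-th Fourier coefficient `∫_a^b e^{imθ} dθ` of an arc. -/
noncomputable def arcCoeff (a b : ℝ) (m : ℤ) : ℂ := ∫ θ in a..b, Complex.exp (m * Complex.I * θ)

/-- The Gram matrix `∫_S z^i conj(z)^j μ_N(dz)` of the monomials over the sector `S`. -/
noncomputable def sectorMoment (N : ℕ) (a b : ℝ) (i j : ℕ) : ℂ :=
  ∫ z, (sector a b).indicator (fun z => z ^ i * (starRingEnd ℂ z) ^ j) z ∂weight N

theorem radialMoment_eq {N : ℕ} (hN : N ≠ 0) (n : ℕ) :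
    radialMoment N n = (N : ℝ) ^ (-((n : ℝ) / 2 + 1)) / 2 * Real.Gamma ((n : ℝ) / 2 + 1) := by
  have hN' : (0 : ℝ) < N := by positivity
  have h := integral_rpow_mul_exp_neg_mul_rpow (p := 2) (q := (n + 1 : ℕ)) (b := N) (by norm_num)
    (by push_cast; linarith [Nat.cast_nonneg (α := ℝ) n]) hN'
  simp only [Real.rpow_natCast, Real.rpow_ofNat] at h
  rw [radialMoment, h]
  have : ((n + 1 : ℕ) + 1 : ℝ) / 2 = (n : ℝ) / 2 + 1 := by push_cast; ring
  rw [neg_div, this]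
  ring

theorem radialMoment_pos {N : ℕ} (hN : N ≠ 0) (n : ℕ) : 0 < radialMoment N n := by
  have hN' : (0 : ℝ) < N := by positivity
  rw [radialMoment_eq hN]
  have := Real.Gamma_pos_of_pos (s := (n : ℝ) / 2 + 1) (by positivity)
  positivity

theorem measurable_weight_density (N : ℕ) :
    Measurable fun z : ℂ => ENNReal.ofReal (Real.exp (-(N : ℝ) * ‖z‖ ^ 2)) := by
  fun_prop

theorem integral_weight (N : ℕ) (f : ℂ → ℂ) :
    ∫ z, f z ∂weight N = ∫ z : ℂ, Real.exp (-(N : ℝ) * ‖z‖ ^ 2) • f z := by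
  rw [weight, integral_withDensity_eq_integral_toReal_smul (measurable_weight_density N)
    (by simp)]
  simp_rw [ENNReal.toReal_ofReal (Real.exp_pos _).le]

instance sigmaFinite_weight (N : ℕ) : SigmaFinite (weight N) := by
  unfold weight
  exact SigmaFinite.withDensity_ofReal _

theorem integrable_monomial {N : ℕ} (hN : N ≠ 0) (i j : ℕ) :
    Integrable (fun z : ℂ => z ^ i * (starRingEnd ℂ z) ^ j) (weight N) := by
  have hN' : (0 : ℝ) < N := by positivity
  rw [weight, integrable_withDensity_iff_integrable_smul' (measurable_weight_density N) (by simp)]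
  have h := Complex.integral_rpow_mul_exp_neg_mul_rpow (p := 2) (q := (i + j : ℕ)) (b := N)
    (by norm_num) (by push_cast; linarith [Nat.cast_nonneg (α := ℝ) i, Nat.cast_nonneg (α := ℝ) j])
    hN'
  simp only [Real.rpow_natCast, Real.rpow_ofNat] at h
  -- a nonzero Bochner integral certifies integrability
  have hi : Integrable (fun z : ℂ => ‖z‖ ^ (i + j) * Real.exp (-(N : ℝ) * ‖z‖ ^ 2)) := by
    refine Integrable.of_integral_ne_zero ?_
    rw [h]
    have := Real.Gamma_pos_of_pos (s := ((i + j : ℕ) + 2 : ℝ) / 2) (by positivity)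
    positivity
  refine hi.mono' ?_ (.of_forall fun z => ?_)
  · have : Measurable (starRingEnd ℂ) := Complex.continuous_conj.measurable
    exact Measurable.aestronglyMeasurable (by fun_prop)
  · rw [norm_smul, ENNReal.toReal_ofReal (Real.exp_pos _).le, norm_mul, norm_pow, norm_pow,
      RCLike.norm_conj, ← pow_add, mul_comm, Real.norm_of_nonneg (Real.exp_pos _).le]

/-- In polar coordinates the Gram matrix factors into a radial moment and a Fourier coefficient. -/
theorem sectorMoment_eq (N : ℕ) {a b : ℝ} (ha : -Real.pi ≤ a) (hab : a ≤ b) (hb : b ≤ Real.pi)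
    (i j : ℕ) :
    sectorMoment N a b i j = radialMoment N (i + j) * arcCoeff a b ((i : ℤ) - j) := by
  -- on the polar rectangle `arg` is the angular coordinate, so the integrand separates
  rw [sectorMoment, integral_weight, ← Complex.integral_comp_polarCoord_symm, polarCoord_target]
  have h1 : ∀ p ∈ Ioi (0 : ℝ) ×ˢ Ioo (-Real.pi) Real.pi,
      p.1 • (Real.exp (-(N : ℝ) * ‖Complex.polarCoord.symm p‖ ^ 2) •
        (sector a b).indicator (fun z => z ^ i * (starRingEnd ℂ z) ^ j)
          (Complex.polarCoord.symm p)) =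
      ((p.1 ^ (i + j + 1) * Real.exp (-N * p.1 ^ 2) : ℝ) : ℂ) *
        (Icc a b).indicator (fun θ : ℝ => Complex.exp (((i : ℤ) - (j : ℤ) : ℤ) * Complex.I * θ)) p.2 := by
    rintro ⟨r, θ⟩ ⟨hr, hθ⟩
    simp only [mem_Ioi] at hr
    have harg := Complex.arg_mul_cos_add_sin_mul_I hr ⟨hθ.1, hθ.2.le⟩
    rw [Complex.norm_polarCoord_symm, Complex.polarCoord_symm_apply]
    simp only [sq_abs]
    by_cases hm : θ ∈ Icc a b
    · rw [indicator_of_mem, indicator_of_mem hm]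
      · have e1 : (Real.cos θ : ℂ) + Real.sin θ * Complex.I = Complex.exp (θ * Complex.I) := by
          rw [Complex.ofReal_cos, Complex.ofReal_sin, Complex.exp_mul_I]
        have e2 : starRingEnd ℂ (Complex.exp (θ * Complex.I)) = Complex.exp (-(θ * Complex.I)) := by
          rw [← Complex.exp_conj]; simp
        rw [e1, map_mul, e2, mul_pow, mul_pow, ← Complex.exp_nat_mul, ← Complex.exp_nat_mul]
        have e3 : Complex.exp (((i : ℤ) - (j : ℤ) : ℤ) * Complex.I * θ) =
            Complex.exp (i * (θ * Complex.I)) * Complex.exp (j * (-(θ * Complex.I))) := by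
          rw [← Complex.exp_add]; congr 1; push_cast; ring
        rw [e3]
        simp only [Complex.real_smul, Complex.conj_ofReal]
        push_cast
        ring
      · simpa only [sector, mem_ofPred_eq, Complex.ofReal_cos, Complex.ofReal_sin, harg] using hm
    · rw [indicator_of_notMem, indicator_of_notMem hm]
      · simp
      · simpa only [sector, mem_ofPred_eq, Complex.ofReal_cos, Complex.ofReal_sin, harg] using hm
  rw [setIntegral_congr_fun (measurableSet_Ioi.prod measurableSet_Ioo) h1, Measure.volume_eq_prod,
    setIntegral_prod_mul (fun r : ℝ => ((r ^ (i + j + 1) * Real.exp (-N * r ^ 2) : ℝ) : ℂ))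
      ((Icc a b).indicator (fun θ : ℝ =>
        Complex.exp (((i : ℤ) - (j : ℤ) : ℤ) * Complex.I * θ))), radialMoment, integral_complex_ofReal]
  congr 1
  rw [arcCoeff, intervalIntegral.integral_of_le hab, setIntegral_indicator measurableSet_Icc,
    ← integral_Icc_eq_integral_Ioc,
    setIntegral_congr_set (Ioo_ae_eq_Icc.inter (ae_eq_refl (Icc a b))), Icc_inter_Icc,
    sup_eq_right.2 ha, inf_eq_right.2 hb]

theorem arcCoeff_of_ne_zero (a b : ℝ) {m : ℤ} (hm : m ≠ 0) :
    ‖arcCoeff a b m‖ ^ 2 = (2 * (1 - Real.cos (m * (b - a)))) / m ^ 2 := by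
  have hm' : (m : ℂ) * Complex.I ≠ 0 := by simp [hm]
  rw [arcCoeff, integral_exp_mul_complex hm', norm_div, div_pow]
  have e : ∀ x : ℝ, Complex.exp (m * Complex.I * x) = Real.cos (m * x) + Real.sin (m * x) * Complex.I := by
    intro x
    rw [Complex.ofReal_cos, Complex.ofReal_sin, ← Complex.exp_mul_I]
    congr 1; push_cast; ring
  congr 1
  · rw [e, e, Complex.sq_norm, Complex.normSq_apply]
    simp only [Complex.add_re, Complex.sub_re, Complex.sub_im, Complex.add_im, Complex.ofReal_re,
      Complex.ofReal_im, Complex.re_ofReal_mul, Complex.im_ofReal_mul, Complex.I_re, Complex.I_im]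
    rw [show (m : ℝ) * (b - a) = m * b - m * a by ring, Real.cos_sub]
    nlinarith [Real.sin_sq_add_cos_sq (m * a), Real.sin_sq_add_cos_sq (m * b)]
  · simp

theorem arcCoeff_zero (a b : ℝ) : arcCoeff a b 0 = (b - a : ℝ) := by
  simp [arcCoeff]

theorem arcCoeff_full {m : ℤ} (hm : m ≠ 0) : arcCoeff (-Real.pi) Real.pi m = 0 := by
  have h := arcCoeff_of_ne_zero (-Real.pi) Real.pi hm
  have : (m : ℝ) * (Real.pi - -Real.pi) = m * (2 * Real.pi) := by ring
  rw [this, Real.cos_int_mul_two_pi] at h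
  simpa using h

theorem sector_full : sector (-Real.pi) Real.pi = univ := by
  ext z
  simp [sector, (Complex.neg_pi_lt_arg z).le, Complex.arg_le_pi z]

theorem integral_monomial (N : ℕ) (i j : ℕ) :
    ∫ z, z ^ i * (starRingEnd ℂ z) ^ j ∂weight N =
      if i = j then ((2 * Real.pi * radialMoment N (2 * i) : ℝ) : ℂ) else 0 := by
  have h := sectorMoment_eq N le_rfl (by linarith [Real.pi_pos]) le_rfl i j
  rw [sectorMoment, sector_full, indicator_univ] at h
  rw [h]
  split_ifs with hij
  · subst hij
    rw [sub_self, arcCoeff_zero, two_mul i]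
    push_cast
    ring
  · rw [arcCoeff_full (by omega), mul_zero]

theorem conj_sectorMoment (N : ℕ) (a b : ℝ) (i j : ℕ) :
    starRingEnd ℂ (sectorMoment N a b i j) = sectorMoment N a b j i := by
  rw [sectorMoment, sectorMoment, ← integral_conj]
  congr 1
  ext z
  by_cases hz : z ∈ sector a b <;> simp [hz, mul_comm]

/-! ### The exact variance of the number of eigenvalues in a sector -/

/-- The ratio `Γ((i+j)/2 + 1)² / (i! j!)`. -/
noncomputable def gammaRatio (i j : ℕ) : ℝ :=
  Real.Gamma ((i + j : ℕ) / 2 + 1) ^ 2 / (i.factorial * j.factorial)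

theorem radialMoment_sq_div {N : ℕ} (hN : N ≠ 0) (i j : ℕ) :
    radialMoment N (i + j) ^ 2 / (radialMoment N (2 * i) * radialMoment N (2 * j)) =
      gammaRatio i j := by
  have hN' : (0 : ℝ) < N := by positivity
  rw [radialMoment_eq hN, radialMoment_eq hN, radialMoment_eq hN, gammaRatio]
  have e : ∀ k : ℕ, ((2 * k : ℕ) : ℝ) / 2 + 1 = k + 1 := fun k => by push_cast; ring
  rw [e, e, Real.Gamma_nat_eq_factorial, Real.Gamma_nat_eq_factorial]
  have h : ((N : ℝ) ^ (-(((i + j : ℕ) : ℝ) / 2 + 1))) ^ 2 =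
      (N : ℝ) ^ (-((i : ℝ) + 1)) * (N : ℝ) ^ (-((j : ℝ) + 1)) := by
    rw [← Real.rpow_natCast, ← Real.rpow_mul hN'.le, ← Real.rpow_add hN']
    congr 1; push_cast; ring
  have p1 : 0 < (N : ℝ) ^ (-((i : ℝ) + 1)) := by positivity
  have p2 : 0 < (N : ℝ) ^ (-((j : ℝ) + 1)) := by positivity
  rw [mul_pow, div_pow, h]
  field_simp

theorem vandermondeSq_eq_det {N : ℕ} (z : Fin N → ℂ) :
    (vandermondeSq z : ℂ) = (Matrix.of fun k i : Fin N => z k ^ (i : ℕ)).det *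
      (Matrix.of fun k j : Fin N => starRingEnd ℂ (z k) ^ (j : ℕ)).det := by
  have h1 : (Matrix.of fun k i : Fin N => z k ^ (i : ℕ)) = Matrix.vandermonde z := rfl
  have h2 : (Matrix.of fun k j : Fin N => starRingEnd ℂ (z k) ^ (j : ℕ)) =
    Matrix.vandermonde fun k => starRingEnd ℂ (z k) := rfl
  rw [h1, h2, Matrix.det_vandermonde, Matrix.det_vandermonde, ← Finset.prod_mul_distrib,
    vandermondeSq]
  rw [Finset.prod_comm' (s' := fun l => Finset.Ioi l) (t' := Finset.univ) (by simp)]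
  push_cast
  refine Finset.prod_congr rfl fun l _ => ?_
  rw [← Finset.prod_mul_distrib]
  refine Finset.prod_congr rfl fun k _ => ?_
  rw [← map_sub, Complex.mul_conj', norm_sub_rev]

theorem vandermondeSq_nonneg {N : ℕ} (z : Fin N → ℂ) : 0 ≤ vandermondeSq z :=
  Finset.prod_nonneg fun _ _ => Finset.prod_nonneg fun _ _ => by positivity

theorem measurable_vandermondeSq {N : ℕ} : Measurable (vandermondeSq (N := N)) := by
  unfold vandermondeSq
  fun_prop

open Classical in
/-- The number of coordinates of `z` that lie in `S`. -/
noncomputable def countIn {N : ℕ} (S : Set ℂ) (z : Fin N → ℂ) : ℕ :=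
  ∑ k, if z k ∈ S then 1 else 0

theorem measurable_countIn {N : ℕ} {S : Set ℂ} (hS : MeasurableSet S) :
    Measurable (countIn (N := N) S) := by
  classical
  unfold countIn
  refine Finset.measurable_fun_sum _ fun k _ => ?_
  exact Measurable.ite (measurable_pi_apply k hS) measurable_const measurable_const

theorem countIn_le {N : ℕ} (S : Set ℂ) (z : Fin N → ℂ) : countIn S z ≤ N := by
  classical
  calc countIn S z ≤ ∑ _k : Fin N, 1 := Finset.sum_le_sum fun k _ => by split_ifs <;> simp
    _ = N := by simp

theorem angularNumber_eq_countIn {N : ℕ} (a b : ℝ) (z : Fin N → ℂ) :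
    angularNumber a b z = countIn (sector a b) z := by
  classical
  simp [angularNumber, linearStatistic, countIn, sector, indicator]

theorem pow_countIn {N : ℕ} (S : Set ℂ) (z : Fin N → ℂ) (t : ℝ) :
    (1 + t) ^ countIn S z = ∏ k, (1 + t * S.indicator (fun _ => (1 : ℝ)) (z k)) := by
  classical
  rw [countIn, ← Finset.prod_pow_eq_pow_sum]
  refine Finset.prod_congr rfl fun k _ => ?_
  by_cases h : z k ∈ S <;> simp [h]

/-- The Gram matrix over the sector of the orthonormalized monomials. -/
noncomputable def overlapMatrix (N : ℕ) (a b : ℝ) : Matrix (Fin N) (Fin N) ℂ :=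
  Matrix.of fun i j => sectorMoment N a b i j /
    ((√(2 * Real.pi * radialMoment N (2 * i)) * √(2 * Real.pi * radialMoment N (2 * j)) : ℝ) : ℂ)

theorem isHermitian_overlapMatrix (N : ℕ) (a b : ℝ) : (overlapMatrix N a b).IsHermitian := by
  ext i j
  simp only [overlapMatrix, Matrix.conjTranspose_apply, Matrix.of_apply, RCLike.star_def, map_div₀,
    conj_sectorMoment, Complex.conj_ofReal]
  rw [mul_comm]

/-- The generating function of the number of eigenvalues in the sector, before normalization: it is
`det (1 + t F)` for the overlap matrix `F`, written through the eigenvalues of `F`. -/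
theorem integral_vandermondeSq_mul_pow {N : ℕ} (hN : N ≠ 0) (a b : ℝ) (t : ℝ) :
    ∫ z, vandermondeSq z * (1 + t) ^ countIn (sector a b) z ∂(Measure.pi fun _ : Fin N => weight N) =
      (N.factorial * ∏ i : Fin N, (2 * Real.pi * radialMoment N (2 * i))) *
        ∏ i, (1 + (isHermitian_overlapMatrix N a b).eigenvalues i * t) := by
  set S := sector a b with hS
  have hSm : MeasurableSet S := measurableSet_sector a b
  set h : Fin N → ℝ := fun i => 2 * Real.pi * radialMoment N (2 * i) with hh
  have hpos : ∀ i, 0 < h i := fun i =>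
    mul_pos (mul_pos two_pos Real.pi_pos) (radialMoment_pos hN _)
  -- the factor `1 + t 1_S` is absorbed into the first determinant
  set u : ℂ → ℂ := fun w => ((1 + t * S.indicator (fun _ => (1 : ℝ)) w : ℝ) : ℂ) with hu
  have hprod : ∀ (i j : ℕ) (w : ℂ), (u w * w ^ i) * starRingEnd ℂ w ^ j =
      w ^ i * starRingEnd ℂ w ^ j + t * S.indicator (fun z => z ^ i * starRingEnd ℂ z ^ j) w := by
    intro i j w
    by_cases hw : w ∈ S
    · simp [hu, hw]
      ring
    · simp [hu, hw]
  have hint1 : ∀ i j : ℕ, Integrable (fun w : ℂ => t * S.indicator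
      (fun z => z ^ i * starRingEnd ℂ z ^ j) w) (weight N) := fun i j =>
    ((integrable_monomial hN i j).indicator hSm).const_mul _
  have hint : ∀ i j : Fin N, Integrable (fun w : ℂ => (u w * w ^ (i : ℕ)) * starRingEnd ℂ w ^ (j : ℕ))
      (weight N) := by
    intro i j
    simp_rw [hprod]
    exact (integrable_monomial hN i j).add (hint1 i j)
  have hA := integral_det_mul_det (weight N) (fun (i : Fin N) w => u w * w ^ (i : ℕ))
    (fun (j : Fin N) w => starRingEnd ℂ w ^ (j : ℕ)) hint
  have hmat : (Matrix.of fun i j : Fin N => ∫ w, (u w * w ^ (i : ℕ)) * starRingEnd ℂ w ^ (j : ℕ)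
      ∂weight N) = Matrix.diagonal (fun i => ((√(h i) : ℝ) : ℂ)) *
        (1 + (t : ℂ) • overlapMatrix N a b) * Matrix.diagonal (fun i => ((√(h i) : ℝ) : ℂ)) := by
    ext i j
    rw [Matrix.mul_diagonal, Matrix.diagonal_mul]
    simp only [Matrix.of_apply, Matrix.add_apply, Matrix.smul_apply, overlapMatrix]
    simp_rw [hprod]
    rw [integral_add (integrable_monomial hN i j) (hint1 i j), integral_monomial, integral_const_mul]
    have hi : ((√(h i) : ℝ) : ℂ) ≠ 0 := by
      exact_mod_cast (Real.sqrt_pos.2 (hpos i)).ne'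
    have hj : ((√(h j) : ℝ) : ℂ) ≠ 0 := by
      exact_mod_cast (Real.sqrt_pos.2 (hpos j)).ne'
    rw [mul_add, add_mul]
    congr 1
    · by_cases hij : i = j
      · subst hij
        rw [if_pos rfl, Matrix.one_apply_eq, mul_one, ← Complex.ofReal_mul,
          Real.mul_self_sqrt (hpos i).le]
      · rw [if_neg (by simpa [Fin.ext_iff] using hij), Matrix.one_apply_ne hij]
        simp
    · change (t : ℂ) * sectorMoment N a b i j = _
      rw [smul_eq_mul, show 2 * Real.pi * radialMoment N (2 * i) = h i from rfl,
        show 2 * Real.pi * radialMoment N (2 * j) = h j from rfl, Complex.ofReal_mul]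
      field_simp
  rw [hmat, Matrix.det_mul, Matrix.det_mul, Matrix.det_diagonal,
    (isHermitian_overlapMatrix N a b).det_one_add_smul_eq_prod] at hA
  have hL : ∀ z : Fin N → ℂ, (Matrix.of fun k i : Fin N => u (z k) * z k ^ (i : ℕ)).det *
      (Matrix.of fun k j : Fin N => starRingEnd ℂ (z k) ^ (j : ℕ)).det =
      ((vandermondeSq z * (1 + t) ^ countIn S z : ℝ) : ℂ) := by
    intro z
    have := Matrix.det_mul_column (fun k => u (z k)) (Matrix.of fun k i : Fin N => z k ^ (i : ℕ))
    simp only [Matrix.of_apply] at this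
    rw [this, mul_assoc, ← vandermondeSq_eq_det, pow_countIn, Complex.ofReal_mul,
      Complex.ofReal_prod, mul_comm]
  simp_rw [hL] at hA
  rw [integral_complex_ofReal, Fintype.card_fin] at hA
  have hd : (∏ i, ((√(h i) : ℝ) : ℂ)) * (∏ i, ((√(h i) : ℝ) : ℂ)) = ((∏ i, h i : ℝ) : ℂ) := by
    rw [← Finset.prod_mul_distrib, Complex.ofReal_prod]
    refine Finset.prod_congr rfl fun i _ => ?_
    rw [← Complex.ofReal_mul, Real.mul_self_sqrt (hpos i).le]
  have : (∏ i, ((√(h i) : ℝ) : ℂ)) * ((∏ i, (1 +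
      (isHermitian_overlapMatrix N a b).eigenvalues i * t) : ℝ) : ℂ) * (∏ i, ((√(h i) : ℝ) : ℂ)) =
      ((∏ i, h i : ℝ) : ℂ) * ((∏ i, (1 +
      (isHermitian_overlapMatrix N a b).eigenvalues i * t) : ℝ) : ℂ) := by
    rw [← hd]; ring
  rw [this] at hA
  rw [mul_assoc]
  exact_mod_cast hA

theorem factorial_mul_prod_radialMoment_pos {N : ℕ} (hN : N ≠ 0) :
    (0 : ℝ) < N.factorial * ∏ i : Fin N, (2 * Real.pi * radialMoment N (2 * i)) :=
  mul_pos (by positivity) (Finset.prod_pos fun i _ =>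
    mul_pos (mul_pos two_pos Real.pi_pos) (radialMoment_pos hN _))

theorem integral_eigenvalueLaw {N : ℕ} (g : (Fin N → ℂ) → ℝ) :
    ∫ z, g z ∂eigenvalueLaw N = (partitionFunction N).toReal⁻¹ *
      ∫ z, vandermondeSq z * g z ∂(Measure.pi fun _ : Fin N => weight N) := by
  rw [eigenvalueLaw, integral_smul_measure, ENNReal.toReal_inv, unnormalizedLaw,
    integral_withDensity_eq_integral_toReal_smul (measurable_vandermondeSq.ennreal_ofReal) (by simp)]
  simp_rw [ENNReal.toReal_ofReal (vandermondeSq_nonneg _), smul_eq_mul]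

/-- In particular the normalizing constant is positive and finite. -/
theorem partitionFunction_eq {N : ℕ} (hN : N ≠ 0) :
    partitionFunction N =
      ENNReal.ofReal (N.factorial * ∏ i : Fin N, (2 * Real.pi * radialMoment N (2 * i))) := by
  have h := integral_vandermondeSq_mul_pow hN 0 0 0
  simp only [add_zero, one_pow, mul_one, mul_zero, Finset.prod_const_one] at h
  have hpos := factorial_mul_prod_radialMoment_pos hN
  have hi : Integrable (vandermondeSq (N := N)) (Measure.pi fun _ : Fin N => weight N) :=
    Integrable.of_integral_ne_zero (h ▸ hpos.ne')
  rw [← h, ofReal_integral_eq_lintegral_ofReal hi (.of_forall vandermondeSq_nonneg),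
    partitionFunction, unnormalizedLaw, withDensity_apply _ MeasurableSet.univ,
    Measure.restrict_univ]

theorem isProbabilityMeasure_eigenvalueLaw {N : ℕ} (hN : N ≠ 0) :
    IsProbabilityMeasure (eigenvalueLaw N) := by
  have hpos := factorial_mul_prod_radialMoment_pos hN
  constructor
  rw [eigenvalueLaw, Measure.smul_apply, smul_eq_mul, ← partitionFunction]
  refine ENNReal.inv_mul_cancel ?_ ?_ <;> rw [partitionFunction_eq hN]
  · exact (ENNReal.ofReal_pos.2 hpos).ne'
  · exact ENNReal.ofReal_ne_top

/-- The exact variance `tr F - tr F²`; the radial integrals contribute only gamma ratios. -/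
theorem angularVariance_eq_sum (N : ℕ) {a b : ℝ} (ha : -Real.pi ≤ a) (hab : a ≤ b)
    (hb : b ≤ Real.pi) :
    angularVariance N a b = N * ((b - a) / (2 * Real.pi)) -
      ∑ i ∈ Finset.range N, ∑ j ∈ Finset.range N,
        ‖arcCoeff a b ((i : ℤ) - j)‖ ^ 2 / (4 * Real.pi ^ 2) * gammaRatio i j := by
  rcases eq_or_ne N 0 with rfl | hN
  · have : angularNumber (N := 0) a b = 0 := by
      ext z; simp [angularNumber, linearStatistic]
    simp [angularVariance, this]
  have := isProbabilityMeasure_eigenvalueLaw hN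
  have hF := isHermitian_overlapMatrix N a b
  have hgen : ∀ t : ℝ, ∫ z, (1 + t) ^ countIn (sector a b) z ∂eigenvalueLaw N =
      ∏ i, (1 + hF.eigenvalues i * t) := by
    intro t
    have hpos := factorial_mul_prod_radialMoment_pos hN
    rw [integral_eigenvalueLaw, integral_vandermondeSq_mul_pow hN, partitionFunction_eq hN,
      ENNReal.toReal_ofReal hpos.le, inv_mul_cancel_left₀ hpos.ne']
  have hv := variance_of_generating_function (eigenvalueLaw N) (countIn (sector a b))
    (measurable_countIn (measurableSet_sector a b)) N (countIn_le _) hF.eigenvalues hgen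
  have hnum : angularNumber (N := N) a b = fun z => (countIn (sector a b) z : ℝ) :=
    funext (angularNumber_eq_countIn a b)
  rw [angularVariance, hnum, hv, hF.sum_eigenvalues_sq]
  have hρ : ∀ n, 0 < radialMoment N n := radialMoment_pos hN
  have hpi := Real.pi_pos
  congr 1
  · have ht := hF.trace_eq_sum_eigenvalues
    have hdiag : ∀ i, overlapMatrix N a b i i = (((b - a) / (2 * Real.pi) : ℝ) : ℂ) := by
      intro i
      simp only [overlapMatrix, Matrix.of_apply]
      rw [Real.mul_self_sqrt (by have := hρ (2 * i); positivity), sectorMoment_eq N ha hab hb,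
        sub_self, arcCoeff_zero, ← Complex.ofReal_mul, ← Complex.ofReal_div]
      congr 1
      have := (hρ (2 * i)).ne'
      rw [← two_mul]
      field_simp
    simp only [Matrix.trace, Matrix.diag_apply, hdiag, Finset.sum_const, Finset.card_univ,
      Fintype.card_fin, nsmul_eq_mul] at ht
    have ht' : ((∑ i, hF.eigenvalues i : ℝ) : ℂ) =
        ((N * ((b - a) / (2 * Real.pi)) : ℝ) : ℂ) := by
      rw [Complex.ofReal_sum]
      rw [Complex.ofReal_mul]
      exact ht.symm
    exact_mod_cast ht'
  · rw [Finset.sum_range]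
    refine Finset.sum_congr rfl fun i _ => ?_
    rw [Finset.sum_range]
    refine Finset.sum_congr rfl fun j _ => ?_
    simp only [overlapMatrix, Matrix.of_apply]
    have h1 := hρ (2 * i)
    have h2 := hρ (2 * j)
    rw [sectorMoment_eq N ha hab hb, norm_div, norm_mul, Complex.norm_real, Complex.norm_real,
      div_pow, mul_pow, Real.norm_eq_abs, Real.norm_eq_abs, sq_abs, sq_abs, mul_pow,
      Real.sq_sqrt (by positivity), Real.sq_sqrt (by positivity), ← radialMoment_sq_div hN]
    field_simp
    norm_num

/-! ### Gaussian bounds for gamma ratios -/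

/-- Log-convexity of `Γ` at the midpoint. -/
theorem Gamma_add_half_sq_le {x : ℝ} (hx : 0 < x) :
    Real.Gamma (x + 1 / 2) ^ 2 ≤ Real.Gamma x * Real.Gamma (x + 1) := by
  have h := Real.Gamma_mul_add_mul_le_rpow_Gamma_mul_rpow_Gamma (s := x) (t := x + 1)
    (a := 1 / 2) (b := 1 / 2) hx (by linarith) (by norm_num) (by norm_num) (by norm_num)
  have e : (1 / 2 : ℝ) * x + 1 / 2 * (x + 1) = x + 1 / 2 := by ring
  rw [e, ← Real.sqrt_eq_rpow, ← Real.sqrt_eq_rpow] at h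
  have h1 := (Real.Gamma_pos_of_pos hx).le
  have h2 := (Real.Gamma_pos_of_pos (by linarith : 0 < x + 1)).le
  calc _ ≤ (√(Real.Gamma x) * √(Real.Gamma (x + 1))) ^ 2 := by
        gcongr
    _ = _ := by rw [mul_pow, Real.sq_sqrt h1, Real.sq_sqrt h2]

theorem le_Gamma_add_half_sq {x : ℝ} (hx : 0 < x) :
    (1 - 1 / (2 * x)) * (Real.Gamma x * Real.Gamma (x + 1)) ≤ Real.Gamma (x + 1 / 2) ^ 2 := by
  have h := Gamma_add_half_sq_le (x := x + 1 / 2) (by linarith)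
  have e : x + 1 / 2 + 1 / 2 = x + 1 := by ring
  rw [e, Real.Gamma_add_one (by linarith : x + 1 / 2 ≠ 0)] at h
  have e2 : Real.Gamma x * Real.Gamma (x + 1) = Real.Gamma (x + 1) ^ 2 / x := by
    rw [Real.Gamma_add_one hx.ne']
    field_simp
  rw [e2]
  have h3 : Real.Gamma (x + 1) ^ 2 / (x + 1 / 2) ≤ Real.Gamma (x + 1 / 2) ^ 2 := by
    rw [div_le_iff₀ (by linarith)]
    linarith
  refine le_trans ?_ h3
  have h4 : (1 - 1 / (2 * x)) / x ≤ 1 / (x + 1 / 2) := by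
    rw [div_le_div_iff₀ hx (by linarith)]
    have : (1 - 1 / (2 * x)) * (x + 1 / 2) = x - 1 / (4 * x) := by field_simp; ring
    rw [this]
    have : 0 < 1 / (4 * x) := by positivity
    linarith
  calc _ = Real.Gamma (x + 1) ^ 2 * ((1 - 1 / (2 * x)) / x) := by ring
    _ ≤ Real.Gamma (x + 1) ^ 2 * (1 / (x + 1 / 2)) := by gcongr
    _ = _ := by ring

/-- Splitting `m = p + q`, the ratio `(j+p)! (j+q)! / (j! (j+p+q)!)`. -/
noncomputable def splitRatio (j p q : ℕ) : ℝ :=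
  ((j + p).factorial * (j + q).factorial : ℝ) / (j.factorial * (j + p + q).factorial)

theorem splitRatio_zero (j q : ℕ) : splitRatio j 0 q = 1 := by
  unfold splitRatio
  simp only [add_zero]
  exact div_self (by positivity)

theorem splitRatio_succ (j p q : ℕ) :
    splitRatio j (p + 1) q = splitRatio j p q * ((j + p + 1 : ℝ) / (j + p + q + 1)) := by
  unfold splitRatio
  have e1 : (j + (p + 1)).factorial = (j + p + 1) * (j + p).factorial := Nat.factorial_succ _
  have e2 : (j + (p + 1) + q).factorial = (j + p + q + 1) * (j + p + q).factorial := by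
    rw [← Nat.factorial_succ]; congr 1; ring
  rw [e1, e2]
  push_cast
  field_simp

theorem splitRatio_pos (j p q : ℕ) : 0 < splitRatio j p q := by
  unfold splitRatio; positivity

theorem exp_le_splitRatio (j p q : ℕ) :
    Real.exp (-(p * q / (j + 1))) ≤ splitRatio j p q := by
  induction p with
  | zero => simp [splitRatio_zero]
  | succ p ih =>
    rw [splitRatio_succ]
    have h : Real.exp (-(q / (j + 1))) ≤ (j + p + 1 : ℝ) / (j + p + q + 1) := by
      rw [Real.exp_neg, ← inv_div (j + p + q + 1 : ℝ)]
      refine inv_anti₀ (by positivity) ?_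
      calc ((j : ℝ) + p + q + 1) / (j + p + 1) = q / (j + p + 1) + 1 := by field_simp; ring
        _ ≤ q / (j + 1) + 1 := by gcongr; linarith [Nat.cast_nonneg (α := ℝ) p]
        _ ≤ _ := Real.add_one_le_exp _
    calc _ = Real.exp (-(p * q / (j + 1))) * Real.exp (-(q / (j + 1))) := by
          rw [← Real.exp_add]; congr 1; push_cast; ring
      _ ≤ _ := mul_le_mul ih h (Real.exp_pos _).le (splitRatio_pos _ _ _).le

theorem splitRatio_le_exp (j p q : ℕ) :
    splitRatio j p q ≤ Real.exp (-(p * q / (j + p + q))) := by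
  induction p with
  | zero => simp [splitRatio_zero]
  | succ p ih =>
    rw [splitRatio_succ]
    have h : (j + p + 1 : ℝ) / (j + p + q + 1) ≤ Real.exp (-(q / (j + p + q + 1))) := by
      have := Real.add_one_le_exp (-(q / (j + p + q + 1) : ℝ))
      refine le_trans (le_of_eq ?_) this
      field_simp
      ring
    calc _ ≤ Real.exp (-(p * q / (j + p + q))) * Real.exp (-(q / (j + p + q + 1))) :=
          mul_le_mul ih h (by positivity) (Real.exp_pos _).le
      _ = Real.exp (-(p * q / (j + p + q) + q / (j + p + q + 1))) := by
          rw [← Real.exp_add]; congr 1; ring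
      _ ≤ _ := by
          refine Real.exp_le_exp.2 (neg_le_neg ?_)
          push_cast
          have h1 : (p * q : ℝ) / (j + p + q + 1) ≤ p * q / (j + p + q) := by
            rcases Nat.eq_zero_or_pos (j + p + q) with h0 | h0
            · have : p = 0 := by omega
              simp [this]
            · have : (0 : ℝ) < j + p + q := by exact_mod_cast h0
              exact div_le_div_of_nonneg_left (by positivity) this (by linarith)
          calc _ = (p * q : ℝ) / (j + p + q + 1) + q / (j + p + q + 1) := by
                rw [← add_div]; congr 1 <;> ring
            _ ≤ _ := by gcongr

theorem gammaRatio_nonneg (i j : ℕ) : 0 ≤ gammaRatio i j := by unfold gammaRatio; positivity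

theorem gammaRatio_comm (i j : ℕ) : gammaRatio i j = gammaRatio j i := by
  unfold gammaRatio; rw [add_comm i j, mul_comm (i.factorial : ℝ)]

theorem gammaRatio_self (i : ℕ) : gammaRatio i i = 1 := by
  unfold gammaRatio
  have : ((i + i : ℕ) : ℝ) / 2 + 1 = i + 1 := by push_cast; ring
  rw [this, Real.Gamma_nat_eq_factorial]
  field_simp

theorem gammaRatio_even (j p : ℕ) : gammaRatio j (j + 2 * p) = splitRatio j p p := by
  unfold gammaRatio splitRatio
  have : ((j + (j + 2 * p) : ℕ) : ℝ) / 2 + 1 = (j + p : ℕ) + 1 := by push_cast; ring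
  rw [this, Real.Gamma_nat_eq_factorial, show j + 2 * p = j + p + p by ring]
  ring

theorem gammaRatio_odd (j p : ℕ) :
    gammaRatio j (j + (2 * p + 1)) ≤ splitRatio j p (p + 1) ∧
    (1 - 1 / (2 * (j + 1))) * splitRatio j p (p + 1) ≤ gammaRatio j (j + (2 * p + 1)) := by
  unfold gammaRatio splitRatio
  have e : ((j + (j + (2 * p + 1)) : ℕ) : ℝ) / 2 + 1 = ((j + p : ℕ) + 1 : ℝ) + 1 / 2 := by
    push_cast; ring
  have e1 : Real.Gamma ((j + p : ℕ) + 1 : ℝ) = (j + p).factorial :=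
    Real.Gamma_nat_eq_factorial _
  have e2 : Real.Gamma ((j + p : ℕ) + 1 + 1 : ℝ) = (j + (p + 1)).factorial := by
    rw [← Real.Gamma_nat_eq_factorial]; push_cast; ring_nf
  have hx : (0 : ℝ) < (j + p : ℕ) + 1 := by positivity
  have h1 := Gamma_add_half_sq_le hx
  have h2 := le_Gamma_add_half_sq hx
  rw [e1, e2] at h1 h2
  rw [e, show j + (2 * p + 1) = j + p + (p + 1) by ring]
  constructor
  · gcongr
  · rw [← mul_div_assoc]
    gcongr
    refine le_trans ?_ h2
    gcongr
    linarith [Nat.cast_nonneg (α := ℝ) p]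

/-- For odd `m = 2p + 1` one has `4 p (p + 1) = m² - 1`, which is where the `-1` comes from. -/
theorem gammaRatio_le_exp (j m : ℕ) :
    gammaRatio j (j + m) ≤ Real.exp (-(((m : ℝ) ^ 2 - 1) / (4 * (j + m)))) := by
  rcases Nat.even_or_odd' m with ⟨p, rfl | rfl⟩
  · rw [gammaRatio_even]
    refine (splitRatio_le_exp _ _ _).trans (Real.exp_le_exp.2 (neg_le_neg ?_))
    push_cast
    calc ((2 * p : ℝ) ^ 2 - 1) / (4 * (j + 2 * p)) ≤ (4 * (p * p)) / (4 * (j + 2 * p)) := by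
          gcongr; nlinarith
      _ = p * p / (j + p + p) := by rw [mul_div_mul_left _ _ (by norm_num)]; ring
  · refine (gammaRatio_odd j p).1.trans ((splitRatio_le_exp _ _ _).trans
      (Real.exp_le_exp.2 (neg_le_neg (le_of_eq ?_))))
    field_simp
    push_cast
    ring

/-- The relative loss `1 / (2 (j + 1))` is the error of replacing `Γ(x + 1/2)²` by `Γ(x) Γ(x + 1)`
for odd `m`. -/
theorem exp_le_gammaRatio (j m : ℕ) :
    (1 - 1 / (2 * (j + 1))) * Real.exp (-((m : ℝ) ^ 2 / (4 * (j + 1)))) ≤ gammaRatio j (j + m) := by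
  have h1 : (1 / (2 * (j + 1)) : ℝ) ≤ 1 / 2 := by
    gcongr
    linarith [Nat.cast_nonneg (α := ℝ) j]
  have h0 : (0 : ℝ) ≤ 1 / (2 * (j + 1)) := by positivity
  rcases Nat.even_or_odd' m with ⟨p, rfl | rfl⟩
  · rw [gammaRatio_even]
    refine le_trans ?_ (exp_le_splitRatio _ _ _)
    have : ((2 * p : ℕ) : ℝ) ^ 2 / (4 * (j + 1)) = p * p / (j + 1) := by
      push_cast; field_simp
      ring
    rw [this]
    exact mul_le_of_le_one_left (Real.exp_pos _).le (by linarith)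
  · refine le_trans ?_ (gammaRatio_odd j p).2
    have : Real.exp (-(((2 * p + 1 : ℕ) : ℝ) ^ 2 / (4 * (j + 1)))) ≤ splitRatio j p (p + 1) := by
      refine le_trans (Real.exp_le_exp.2 (neg_le_neg ?_)) (exp_le_splitRatio _ _ _)
      rw [div_le_div_iff₀ (by positivity) (by positivity)]
      push_cast
      nlinarith [Nat.cast_nonneg (α := ℝ) j]
    exact mul_le_mul_of_nonneg_left this (by linarith)

theorem gammaRatio_le_one (j m : ℕ) : gammaRatio j (j + m) ≤ 1 := by
  rcases Nat.eq_zero_or_pos m with rfl | hm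
  · rw [add_zero, gammaRatio_self]
  · refine (gammaRatio_le_exp j m).trans (Real.exp_le_one_iff.2 (neg_nonpos.2 ?_))
    have : (1 : ℝ) ≤ m := by exact_mod_cast hm
    have : (0 : ℝ) ≤ (m : ℝ) ^ 2 - 1 := by nlinarith
    positivity

/-- The gamma ratio is a Gaussian in `m` of variance `2 (j + 1)`, up to an error which after division
by `m²` is a sum of three terms, each telescoping in `m` with total `O(1 / (j + 1))`. The second
term governs `m ≤ j + 1`, the third `m > j + 1`. -/
theorem abs_gammaRatio_sub_exp_le (j m : ℕ) (hm : 1 ≤ m) :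
    |gammaRatio j (j + m) - Real.exp (-((m : ℝ) ^ 2 / (4 * (j + 1))))| / m ^ 2 ≤
      128 * (1 / ((j + 1) * m ^ 2) + m / (j + 1 + m ^ 2) ^ 2 + 1 / (j + 1 + m) ^ 2) := by
  have hm1 : (1 : ℝ) ≤ m := by exact_mod_cast hm
  have hm0 : (0 : ℝ) < m := by linarith
  obtain ⟨J, hJ⟩ : ∃ J : ℝ, J = j + 1 := ⟨_, rfl⟩
  have hJ1 : 1 ≤ J := by rw [hJ]; linarith [Nat.cast_nonneg (α := ℝ) j]
  have hlow := exp_le_gammaRatio j m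
  have hup := gammaRatio_le_exp j m
  have hone := gammaRatio_le_one j m
  rw [show (4 * ((j : ℝ) + m)) = 4 * (J + m - 1) by rw [hJ]; ring] at hup
  rw [← hJ] at hlow ⊢
  have hE1 : Real.exp (-((m : ℝ) ^ 2 / (4 * J))) ≤ 1 :=
    Real.exp_le_one_iff.2 (neg_nonpos.2 (by positivity))
  have hE0 := Real.exp_pos (-((m : ℝ) ^ 2 / (4 * J)))
  set E := Real.exp (-((m : ℝ) ^ 2 / (4 * J))) with hE
  have t1 : 0 ≤ 1 / (J * (m : ℝ) ^ 2) := by positivity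
  have t2 : 0 ≤ (m : ℝ) / (J + (m : ℝ) ^ 2) ^ 2 := by positivity
  have t3 : 0 ≤ 1 / (J + (m : ℝ)) ^ 2 := by positivity
  rw [div_le_iff₀ (by positivity), abs_le]
  have m1 : 1 / (J * (m : ℝ) ^ 2) * m ^ 2 = 1 / J := by field_simp
  constructor
  · have h : -(1 / J) ≤ gammaRatio j (j + m) - E := by
      have : 1 / (2 * J) * E ≤ 1 / J := by
        calc 1 / (2 * J) * E ≤ 1 / (2 * J) * 1 := by gcongr
          _ ≤ 1 / J := by rw [mul_one]; gcongr; linarith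
      linarith
    have : (1 / (J * (m : ℝ) ^ 2) + m / (J + m ^ 2) ^ 2 + 1 / (J + m) ^ 2) * m ^ 2 ≥ 1 / J := by
      rw [← m1]; gcongr; linarith
    have : 0 ≤ 1 / J := by positivity
    linarith
  · rcases le_or_gt (m : ℝ) J with hmJ | hmJ
    · set a := ((m : ℝ) ^ 2 - 1) / (4 * (J + m - 1)) with ha
      have hden : 0 < J + m - 1 := by linarith
      -- mean value inequality `e^{-a} - e^{-b} ≤ (b - a) e^{-a}`
      have h1 : Real.exp (-a) - E ≤ (m ^ 2 / (4 * J) - a) * Real.exp (-a) := by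
        have : E = Real.exp (-a) * Real.exp (a - m ^ 2 / (4 * J)) := by
          rw [← Real.exp_add, hE]; congr 1; ring
        have h2 := Real.add_one_le_exp (a - m ^ 2 / (4 * J))
        rw [this]
        nlinarith [Real.exp_pos (-a)]
      have h2 : m ^ 2 / (4 * J) - a ≤ (m ^ 3 + J) / (4 * J ^ 2) := by
        rw [ha, div_sub_div _ _ (by positivity) (by positivity),
          div_le_div_iff₀ (by positivity) (by positivity)]
        have : (m : ℝ) ^ 2 * (4 * (J + m - 1)) - 4 * J * (m ^ 2 - 1) = 4 * (m ^ 2 * (m - 1) + J) := by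
          ring
        rw [this]
        have : (m : ℝ) ^ 2 * (m - 1) + J ≤ m ^ 3 + J := by nlinarith
        have h5 : J ≤ J + m - 1 := by linarith
        calc 4 * ((m : ℝ) ^ 2 * (m - 1) + J) * (4 * J ^ 2) ≤ 4 * (m ^ 3 + J) * (4 * J ^ 2) := by gcongr
          _ = (m ^ 3 + J) * (4 * J * (4 * J)) := by ring
          _ ≤ _ := by gcongr
      have h3 : Real.exp (-a) ≤ 256 * J ^ 2 / (J + m ^ 2) ^ 2 := by
        have ha' : ((m : ℝ) ^ 2 - 1) / (8 * J) ≤ a := by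
          rw [ha]
          have : 0 ≤ (m : ℝ) ^ 2 - 1 := by nlinarith
          exact div_le_div_of_nonneg_left this (by positivity) (by linarith)
        have h4 : (J + m ^ 2) / (16 * J) ≤ Real.exp (a / 2) := by
          refine le_trans ?_ (Real.add_one_le_exp _)
          have : (J + (m : ℝ) ^ 2) / (16 * J) ≤ ((m : ℝ) ^ 2 - 1) / (8 * J) / 2 + 1 := by
            rw [div_div, show 8 * J * 2 = 16 * J by ring, div_add_one (by positivity)]
            exact div_le_div_of_nonneg_right (by linarith) (by positivity)
          linarith
        have h5 : ((J + m ^ 2) / (16 * J)) ^ 2 ≤ Real.exp a := by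
          calc _ ≤ Real.exp (a / 2) ^ 2 := by gcongr
            _ = Real.exp a := by rw [← Real.exp_nat_mul]; congr 1; push_cast; ring
        rw [Real.exp_neg]
        calc (Real.exp a)⁻¹ ≤ (((J + (m : ℝ) ^ 2) / (16 * J)) ^ 2)⁻¹ := inv_anti₀ (by positivity) h5
          _ = _ := by field_simp; norm_num
      have h6 : Real.exp (-a) ≤ 1 := by
        refine Real.exp_le_one_iff.2 (neg_nonpos.2 ?_)
        have : 0 ≤ (m : ℝ) ^ 2 - 1 := by nlinarith
        rw [ha]; positivity
      have h7 : gammaRatio j (j + m) - E ≤ m ^ 3 / (4 * J ^ 2) * Real.exp (-a) + 1 / (4 * J) := by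
        have e : (m ^ 3 + J) / (4 * J ^ 2) = (m : ℝ) ^ 3 / (4 * J ^ 2) + 1 / (4 * J) := by
          field_simp
        rw [e] at h2
        have := mul_le_mul_of_nonneg_right h2 (Real.exp_pos (-a)).le
        have h8 : 1 / (4 * J) * Real.exp (-a) ≤ 1 / (4 * J) := mul_le_of_le_one_right (by positivity) h6
        linarith
      have h8 : (m : ℝ) ^ 3 / (4 * J ^ 2) * Real.exp (-a) ≤ 64 * (m / (J + m ^ 2) ^ 2 * m ^ 2) := by
        calc _ ≤ (m : ℝ) ^ 3 / (4 * J ^ 2) * (256 * J ^ 2 / (J + m ^ 2) ^ 2) := by gcongr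
          _ = _ := by field_simp; norm_num
      have h9 : 1 / (4 * J) ≤ 1 / J := by gcongr; linarith
      have h10 : 0 ≤ 1 / (J + (m : ℝ)) ^ 2 * m ^ 2 := by positivity
      have h11 : 0 ≤ m / (J + (m : ℝ) ^ 2) ^ 2 * m ^ 2 := by positivity
      have h12 : 0 < 1 / J := by positivity
      rw [mul_assoc, add_mul, add_mul, m1]
      linarith
    · have h3 : 1 ≤ 4 * (1 / (J + (m : ℝ)) ^ 2 * m ^ 2) := by
        rw [one_div_mul_eq_div, ← mul_div_assoc, le_div_iff₀ (by positivity)]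
        nlinarith
      rw [mul_assoc, add_mul, add_mul, m1]
      have h11 : 0 ≤ m / (J + (m : ℝ) ^ 2) ^ 2 * m ^ 2 := by positivity
      have h12 : 0 < 1 / J := by positivity
      linarith

/-! ### Reduction to sums over Fourier modes -/

theorem sum_le_of_telescoping {f F : ℕ → ℝ} (hF : ∀ k, 0 ≤ F k)
    (h : ∀ k, f k ≤ F k - F (k + 1)) (M : ℕ) : ∑ k ∈ Finset.range M, f k ≤ F 0 :=
  calc ∑ k ∈ Finset.range M, f k ≤ ∑ k ∈ Finset.range M, (F k - F (k + 1)) :=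
        Finset.sum_le_sum fun k _ => h k
    _ = F 0 - F M := Finset.sum_range_sub' _ _
    _ ≤ F 0 := by linarith [hF M]

theorem sum_one_div_add_sq_le {r : ℝ} (hr : 1 ≤ r) (M : ℕ) :
    ∑ k ∈ Finset.range M, 1 / (r + k) ^ 2 ≤ 2 / r := by
  have := sum_le_of_telescoping (f := fun k => 1 / (r + k) ^ 2) (F := fun k => 2 / (r + k))
    (fun k => by positivity) (fun k => ?_) M
  · simpa using this
  · have hk : (0 : ℝ) ≤ k := k.cast_nonneg
    push_cast
    rw [div_sub_div _ _ (by positivity) (by positivity), div_le_div_iff₀ (by positivity) (by positivity)]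
    nlinarith [mul_pos (by linarith : 0 < r + k) (by linarith : 0 < r + k)]

theorem summable_one_div_add_sq {r : ℝ} (hr : 1 ≤ r) :
    Summable fun k : ℕ => 1 / (r + k) ^ 2 :=
  summable_of_sum_range_le (fun _ => by positivity) (sum_one_div_add_sq_le hr)

theorem tsum_one_div_add_sq_le {r : ℝ} (hr : 1 ≤ r) : ∑' k : ℕ, 1 / (r + k) ^ 2 ≤ 2 / r :=
  Real.tsum_le_of_sum_range_le (fun _ => by positivity) (sum_one_div_add_sq_le hr)

theorem sum_div_add_sq_sq_le {J : ℝ} (hJ : 1 ≤ J) (M : ℕ) :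
    ∑ k ∈ Finset.range M, ((k + 1 : ℕ) : ℝ) / (J + ((k + 1 : ℕ) : ℝ) ^ 2) ^ 2 ≤ 1 / J := by
  have := sum_le_of_telescoping (f := fun k => ((k + 1 : ℕ) : ℝ) / (J + ((k + 1 : ℕ) : ℝ) ^ 2) ^ 2)
    (F := fun k => 1 / (J + k * (k + 1))) (fun k => by positivity) (fun k => ?_) M
  · simpa using this
  · have hk : (0 : ℝ) ≤ k := k.cast_nonneg
    push_cast
    rw [div_sub_div _ _ (by positivity) (by positivity), div_le_div_iff₀ (by positivity) (by positivity)]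
    have e : (1 * (J + (k + 1 : ℝ) * (k + 1 + 1)) - (J + (k : ℝ) * (k + 1)) * 1) = 2 * (k + 1) := by ring
    have e2 : (J + (k : ℝ) * (k + 1)) * (J + (k + 1 : ℝ) * (k + 1 + 1)) =
        (J + (k + 1 : ℝ) ^ 2) ^ 2 - (k + 1) ^ 2 := by ring
    rw [e, e2]
    have : 0 ≤ (J + (k + 1 : ℝ) ^ 2) ^ 2 := by positivity
    nlinarith [mul_nonneg hk this, mul_nonneg hk (sq_nonneg (k + 1 : ℝ)), sq_nonneg (k + 1 : ℝ)]

theorem sum_abs_gammaRatio_sub_exp_le (j M : ℕ) :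
    ∑ k ∈ Finset.range M, |gammaRatio j (j + (k + 1)) -
      Real.exp (-(((k + 1 : ℕ) : ℝ) ^ 2 / (4 * (j + 1))))| / ((k + 1 : ℕ) : ℝ) ^ 2 ≤
        640 / (j + 1) := by
  obtain ⟨J, hJ⟩ : ∃ J : ℝ, J = j + 1 := ⟨_, rfl⟩
  have hJ1 : 1 ≤ J := by rw [hJ]; linarith [Nat.cast_nonneg (α := ℝ) j]
  have h1 : ∑ k ∈ Finset.range M, 1 / (J * ((k + 1 : ℕ) : ℝ) ^ 2) ≤ 2 / J := by
    have := sum_one_div_add_sq_le le_rfl M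
    have e : ∀ k : ℕ, 1 / (J * ((k + 1 : ℕ) : ℝ) ^ 2) = 1 / J * (1 / (1 + (k : ℝ)) ^ 2) := by
      intro k; push_cast; rw [add_comm (k : ℝ) 1]; field_simp
    simp_rw [e]
    rw [← Finset.mul_sum]
    calc _ ≤ 1 / J * (2 / 1) := by gcongr
      _ = _ := by ring
  have h2 := sum_div_add_sq_sq_le hJ1 M
  have h3 : ∑ k ∈ Finset.range M, 1 / (J + ((k + 1 : ℕ) : ℝ)) ^ 2 ≤ 2 / J := by
    refine le_trans (Finset.sum_le_sum fun k _ => ?_) (sum_one_div_add_sq_le hJ1 M)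
    push_cast
    gcongr
    linarith
  calc _ ≤ ∑ k ∈ Finset.range M, 128 * (1 / (J * ((k + 1 : ℕ) : ℝ) ^ 2) +
        ((k + 1 : ℕ) : ℝ) / (J + ((k + 1 : ℕ) : ℝ) ^ 2) ^ 2 + 1 / (J + ((k + 1 : ℕ) : ℝ)) ^ 2) := by
        refine Finset.sum_le_sum fun k _ => ?_
        rw [hJ]
        exact abs_gammaRatio_sub_exp_le j (k + 1) (by omega)
    _ ≤ 128 * (2 / J + 1 / J + 2 / J) := by
        rw [← Finset.mul_sum, Finset.sum_add_distrib, Finset.sum_add_distrib]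
        gcongr
    _ = 640 / (j + 1) := by rw [← hJ]; ring

/-- The squared modulus of the `m`-th Fourier coefficient of an arc of length `L`,
`(1 - cos (m L)) / (2 π² m²)`, for `m ≠ 0`. -/
noncomputable def arcWeight (L : ℝ) (m : ℕ) : ℝ :=
  (1 - Real.cos (m * L)) / (2 * Real.pi ^ 2 * m ^ 2)

theorem arcWeight_nonneg (L : ℝ) (m : ℕ) : 0 ≤ arcWeight L m :=
  div_nonneg (by linarith [Real.cos_le_one (m * L)]) (by positivity)

theorem arcWeight_le (L : ℝ) (m : ℕ) : arcWeight L m ≤ 1 / m ^ 2 := by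
  rcases Nat.eq_zero_or_pos m with rfl | hm
  · simp [arcWeight]
  have : (0 : ℝ) < m := by exact_mod_cast hm
  unfold arcWeight
  rw [div_le_div_iff₀ (by positivity) (by positivity)]
  have h1 := Real.neg_one_le_cos (m * L)
  have h2 : 1 ≤ Real.pi ^ 2 := by nlinarith [Real.pi_gt_three]
  have h3 : 0 < (m : ℝ) ^ 2 := by positivity
  nlinarith [mul_le_mul_of_nonneg_right h2 h3.le]

theorem arcWeight_le_sq (L : ℝ) (m : ℕ) : arcWeight L m ≤ L ^ 2 / (4 * Real.pi ^ 2) := by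
  rcases Nat.eq_zero_or_pos m with rfl | hm
  · simp [arcWeight]; positivity
  have : (0 : ℝ) < m := by exact_mod_cast hm
  have hpi := Real.pi_pos
  unfold arcWeight
  rw [div_le_div_iff₀ (by positivity) (by positivity)]
  have h1 := Real.one_sub_sq_div_two_le_cos (x := m * L)
  have h2 : 0 < Real.pi ^ 2 := by positivity
  nlinarith [mul_le_mul_of_nonneg_right (by linarith : 1 - Real.cos (m * L) ≤ (m * L) ^ 2 / 2) h2.le]

/-- Parseval for the indicator of an arc, in the form `∑_{m ≠ 0} |c_m|² = c_0 - c_0²`. -/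
theorem hasSum_arcWeight {L : ℝ} (h0 : 0 ≤ L) (h1 : L ≤ 2 * Real.pi) :
    HasSum (fun k : ℕ => 2 * arcWeight L (k + 1))
      (L / (2 * Real.pi) - L ^ 2 / (4 * Real.pi ^ 2)) := by
  have hpi := Real.pi_pos
  have hx : L / (2 * Real.pi) ∈ Icc (0 : ℝ) 1 := ⟨by positivity, by rw [div_le_one (by positivity)]; exact h1⟩
  have hc := hasSum_one_div_nat_pow_mul_cos one_ne_zero hx
  have hz := hasSum_zeta_two
  have hs := (hz.sub hc).mul_left (1 / Real.pi ^ 2)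
  have hB : (Polynomial.map (algebraMap ℚ ℝ) (Polynomial.bernoulli (2 * 1))).eval (L / (2 * Real.pi)) =
      (L / (2 * Real.pi)) ^ 2 - L / (2 * Real.pi) + 1 / 6 := by
    have : Polynomial.bernoulli (2 * 1) = Polynomial.X ^ 2 - Polynomial.X + Polynomial.C (1 / 6 : ℚ) := by
      rw [Polynomial.bernoulli_def]
      simp [Finset.sum_range_succ, bernoulli_one, bernoulli_two, ← Polynomial.C_mul_X_pow_eq_monomial]
      have h2 : Polynomial.C (-1 / 2 : ℚ) * 2 = -1 := by
        rw [show (2 : Polynomial ℚ) = Polynomial.C 2 from rfl, ← Polynomial.C_mul]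
        norm_num
      linear_combination Polynomial.X * h2
    rw [this]
    simp
  rw [hB] at hs
  have hs' := (hasSum_nat_add_iff' 1).2 hs
  simp only [Finset.range_one, Finset.sum_singleton] at hs'
  convert! hs' using 1
  · ext k
    unfold arcWeight
    have : (0 : ℝ) < (k + 1 : ℕ) := by positivity
    have e : 2 * Real.pi * ((k + 1 : ℕ) : ℝ) * (L / (2 * Real.pi)) = (k + 1 : ℕ) * L := by field_simp
    rw [e]
    field_simp
    ring
  · simp [Nat.factorial]
    field_simp
    ring

theorem summable_arcWeight (L : ℝ) : Summable fun k : ℕ => arcWeight L (k + 1) := by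
  refine Summable.of_nonneg_of_le (fun _ => arcWeight_nonneg _ _) (fun k => ?_)
    (summable_one_div_add_sq (r := 1) le_rfl)
  refine (arcWeight_le _ _).trans (le_of_eq ?_)
  push_cast; ring

theorem sum_range_symm (F : ℕ → ℕ → ℝ) (hF : ∀ i j, F i j = F j i) (N : ℕ) :
    ∑ i ∈ Finset.range N, ∑ j ∈ Finset.range N, F i j = ∑ i ∈ Finset.range N, F i i +
      2 * ∑ i ∈ Finset.range N, ∑ k ∈ Finset.range (N - (i + 1)), F i (i + (k + 1)) := by
  have h : ∑ i ∈ Finset.range N, ∑ j ∈ Finset.range N, F i j = ∑ i ∈ Finset.range N, F i i +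
      2 * ∑ i ∈ Finset.range N, ∑ j ∈ Finset.Ico (i + 1) N, F i j := by
    induction N with
    | zero => simp
    | succ N ih =>
      have e : ∀ i ∈ Finset.range N, ∑ j ∈ Finset.Ico (i + 1) (N + 1), F i j =
          ∑ j ∈ Finset.Ico (i + 1) N, F i j + F i N := fun i hi =>
        Finset.sum_Ico_succ_top (by have := Finset.mem_range.1 hi; omega) _
      simp only [Finset.sum_range_succ _ N, Finset.sum_add_distrib, ih, Finset.Ico_self,
        Finset.sum_empty, add_zero]
      rw [Finset.sum_congr rfl e, Finset.sum_add_distrib, Finset.sum_congr rfl fun j _ => hF N j]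
      ring
  rw [h]
  congr 2
  refine Finset.sum_congr rfl fun i _ => ?_
  rw [Finset.sum_Ico_eq_sum_range]
  refine Finset.sum_congr rfl fun k _ => ?_
  congr 1; ring

/-- The variance depends on the arc only through its length `b - a`. -/
theorem angularVariance_eq (N : ℕ) {a b : ℝ} (ha : -Real.pi ≤ a) (hab : a ≤ b)
    (hb : b ≤ Real.pi) :
    angularVariance N a b =
      N * ((b - a) / (2 * Real.pi) - (b - a) ^ 2 / (4 * Real.pi ^ 2)) -
      2 * ∑ i ∈ Finset.range N, ∑ k ∈ Finset.range (N - (i + 1)),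
        arcWeight (b - a) (k + 1) * gammaRatio i (i + (k + 1)) := by
  have hw : ∀ i j : ℕ, i ≠ j → ‖arcCoeff a b ((i : ℤ) - j)‖ ^ 2 =
      (2 * (1 - Real.cos (((i : ℝ) - j) * (b - a)))) / ((i : ℝ) - j) ^ 2 := by
    intro i j hij
    rw [arcCoeff_of_ne_zero a b (by omega)]
    push_cast; rfl
  rw [angularVariance_eq_sum N ha hab hb, sum_range_symm]
  · have hd : ∀ i : ℕ, ‖arcCoeff a b ((i : ℤ) - i)‖ ^ 2 / (4 * Real.pi ^ 2) * gammaRatio i i =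
        (b - a) ^ 2 / (4 * Real.pi ^ 2) := by
      intro i
      rw [sub_self, arcCoeff_zero, gammaRatio_self, Complex.norm_real, Real.norm_eq_abs, sq_abs,
        mul_one]
    simp only [hd, Finset.sum_const, Finset.card_range, nsmul_eq_mul]
    have ho : ∀ i k : ℕ, ‖arcCoeff a b ((i : ℤ) - (i + (k + 1) : ℕ))‖ ^ 2 / (4 * Real.pi ^ 2) =
        arcWeight (b - a) (k + 1) := by
      intro i k
      rw [hw i _ (by omega), arcWeight]
      have e : (i : ℝ) - (i + (k + 1) : ℕ) = -((k + 1 : ℕ) : ℝ) := by push_cast; ring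
      rw [e, neg_mul, Real.cos_neg, neg_sq]
      have : (0 : ℝ) < (k + 1 : ℕ) := by positivity
      have := Real.pi_pos
      field_simp
      ring
    simp only [ho]
    ring
  · intro i j
    rw [gammaRatio_comm i j]
    rcases eq_or_ne i j with rfl | hij
    · rfl
    rw [hw i j hij, hw j i hij.symm]
    have e : (i : ℝ) - j = -((j : ℝ) - i) := by ring
    rw [e, neg_mul, Real.cos_neg, neg_sq]

/-- The contribution to the variance of the angular index `J - 1` once the gamma ratios are
replaced by Gaussians: `2 ∑_{m ≥ 1} arcWeight L m (1 - e^{-m²/(4J)})`. -/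
noncomputable def blockVariance (L J : ℝ) : ℝ :=
  ∑' k : ℕ, 2 * arcWeight L (k + 1) * (1 - Real.exp (-(((k + 1 : ℕ) : ℝ) ^ 2 / (4 * J))))

/-- The row `j` of the variance formula: by Parseval its diagonal part is `∑_m 2 arcWeight L m` over all
`m ≥ 1`, of which only the first `M` terms are damped by gamma ratios. -/
theorem abs_row_sub_blockVariance_le {L : ℝ} (h0 : 0 ≤ L) (h1 : L ≤ 2 * Real.pi) (j M : ℕ) :
    |(L / (2 * Real.pi) - L ^ 2 / (4 * Real.pi ^ 2)) -
      2 * ∑ k ∈ Finset.range M, arcWeight L (k + 1) * gammaRatio j (j + (k + 1)) -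
      blockVariance L (j + 1)| ≤ 1280 / ((j : ℝ) + 1) + 4 / ((M : ℝ) + 1) := by
  set e : ℕ → ℝ := fun k => Real.exp (-(((k + 1 : ℕ) : ℝ) ^ 2 / (4 * ((j : ℝ) + 1)))) with he
  have he0 : ∀ k, 0 ≤ e k := fun k => (Real.exp_pos _).le
  have he1 : ∀ k, e k ≤ 1 := fun k => Real.exp_le_one_iff.2 (neg_nonpos.2 (by positivity))
  have hw := hasSum_arcWeight h0 h1
  have hse : Summable fun k => arcWeight L (k + 1) * e k :=
    Summable.of_nonneg_of_le (fun k => mul_nonneg (arcWeight_nonneg _ _) (he0 k))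
      (fun k => mul_le_of_le_one_right (arcWeight_nonneg _ _) (he1 k)) (summable_arcWeight L)
  have hT : blockVariance L (j + 1) = (L / (2 * Real.pi) - L ^ 2 / (4 * Real.pi ^ 2)) -
      2 * ∑' k, arcWeight L (k + 1) * e k := by
    rw [← hw.tsum_eq, ← tsum_mul_left, ← (hw.summable).tsum_sub (hse.mul_left 2), blockVariance]
    congr 1; ext k; simp only [he]; ring
  rw [hT, ← hse.sum_add_tsum_nat_add M]
  have htail0 : 0 ≤ ∑' k, arcWeight L (k + M + 1) * e (k + M) :=
    tsum_nonneg fun k => mul_nonneg (arcWeight_nonneg _ _) (he0 _)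
  have htail : ∑' k, arcWeight L (k + M + 1) * e (k + M) ≤ 2 / (M + 1) := by
    have hr : (1 : ℝ) ≤ M + 1 := by linarith [Nat.cast_nonneg (α := ℝ) M]
    refine le_trans ((((summable_nat_add_iff M).2 hse)).tsum_le_tsum (fun k => ?_)
      (summable_one_div_add_sq hr)) (tsum_one_div_add_sq_le hr)
    calc _ ≤ arcWeight L (k + M + 1) := mul_le_of_le_one_right (arcWeight_nonneg _ _) (he1 _)
      _ ≤ 1 / ((k + M + 1 : ℕ) : ℝ) ^ 2 := arcWeight_le _ _
      _ = _ := by push_cast; ring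
  have hmain : |∑ k ∈ Finset.range M, arcWeight L (k + 1) * e k -
      ∑ k ∈ Finset.range M, arcWeight L (k + 1) * gammaRatio j (j + (k + 1))| ≤ 640 / (j + 1) := by
    refine le_trans ?_ (sum_abs_gammaRatio_sub_exp_le j M)
    rw [← Finset.sum_sub_distrib]
    refine (Finset.abs_sum_le_sum_abs _ _).trans (Finset.sum_le_sum fun k _ => ?_)
    rw [← mul_sub, abs_mul, abs_of_nonneg (arcWeight_nonneg _ _), abs_sub_comm]
    have := mul_le_mul_of_nonneg_right (arcWeight_le L (k + 1))
      (abs_nonneg (gammaRatio j (j + (k + 1)) - e k))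
    refine this.trans (le_of_eq ?_)
    rw [one_div_mul_eq_div]
  have hj : (1280 : ℝ) / (j + 1) = 2 * (640 / (j + 1)) := by ring
  have hM : (4 : ℝ) / (M + 1) = 2 * (2 / (M + 1)) := by ring
  rw [hj, hM]
  rw [abs_le] at hmain ⊢
  constructor <;> linarith [hmain.1, hmain.2]

theorem sum_inv_le_one_add_log (N : ℕ) :
    ∑ i ∈ Finset.range N, 1 / ((i : ℝ) + 1) ≤ 1 + Real.log N := by
  have h := harmonic_le_one_add_log N
  rw [harmonic] at h
  push_cast at h
  simpa [one_div] using h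

theorem abs_angularVariance_sub_sum_blockVariance_le (N : ℕ) {a b : ℝ} (ha : -Real.pi ≤ a)
    (hab : a ≤ b) (hb : b ≤ Real.pi) :
    |angularVariance N a b - ∑ j ∈ Finset.range N, blockVariance (b - a) (j + 1)| ≤
      1284 * (1 + Real.log N) := by
  have hN := sum_inv_le_one_add_log N
  rw [angularVariance_eq N ha hab hb, Finset.mul_sum]
  have e : (N : ℝ) * ((b - a) / (2 * Real.pi) - (b - a) ^ 2 / (4 * Real.pi ^ 2)) =
    ∑ j ∈ Finset.range N, ((b - a) / (2 * Real.pi) - (b - a) ^ 2 / (4 * Real.pi ^ 2)) := by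
    rw [Finset.sum_const, Finset.card_range, nsmul_eq_mul]
  rw [e, ← Finset.sum_sub_distrib, ← Finset.sum_sub_distrib]
  refine (Finset.abs_sum_le_sum_abs _ _).trans ?_
  refine (Finset.sum_le_sum fun j _ => abs_row_sub_blockVariance_le (L := b - a) (by linarith) (by linarith)
    j (N - (j + 1))).trans ?_
  rw [Finset.sum_add_distrib]
  -- the truncation errors `4 / (N - j)` sum, in reverse order, to a harmonic number
  have h2 : ∑ j ∈ Finset.range N, 4 / (((N - (j + 1) : ℕ) : ℝ) + 1) =
      4 * ∑ i ∈ Finset.range N, 1 / ((i : ℝ) + 1) := by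
    rw [Finset.mul_sum, ← Finset.sum_range_reflect (fun i : ℕ => 4 * (1 / ((i : ℝ) + 1)))]
    refine Finset.sum_congr rfl fun j hj => ?_
    rw [show N - 1 - j = N - (j + 1) by omega]
    ring
  have h1 : ∑ j ∈ Finset.range N, 1280 / ((j : ℝ) + 1) =
      1280 * ∑ i ∈ Finset.range N, 1 / ((i : ℝ) + 1) := by
    rw [Finset.mul_sum]
    refine Finset.sum_congr rfl fun j hj => by ring
  rw [h1, h2]
  linarith

/-! ### The crossover function -/

/-- The Gaussian tail `∫_a^∞ e^{-θ²} dθ`. -/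
noncomputable def gaussTail (a : ℝ) : ℝ := ∫ θ in Ioi a, Real.exp (-θ ^ 2)

theorem integrable_exp_neg_sq : Integrable fun θ : ℝ => Real.exp (-θ ^ 2) := by
  simpa using integrable_exp_neg_mul_sq one_pos

theorem gaussTail_nonneg (a : ℝ) : 0 ≤ gaussTail a :=
  setIntegral_nonneg measurableSet_Ioi fun _ _ => (Real.exp_pos _).le

theorem gaussTail_zero : gaussTail 0 = √Real.pi / 2 := by
  simpa [gaussTail] using integral_gaussian_Ioi 1

theorem gaussTail_eq (a : ℝ) : gaussTail a = gaussTail 0 - ∫ θ in (0 : ℝ)..a, Real.exp (-θ ^ 2) := by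
  have := intervalIntegral.integral_Ioi_sub_Ioi' (a := 0) (b := a)
    integrable_exp_neg_sq.integrableOn integrable_exp_neg_sq.integrableOn
  unfold gaussTail
  linarith

theorem hasDerivAt_gaussTail (a : ℝ) : HasDerivAt gaussTail (-Real.exp (-a ^ 2)) a := by
  have hc : Continuous fun θ : ℝ => Real.exp (-θ ^ 2) := by fun_prop
  have h := (intervalIntegral.integral_hasDerivAt_right (hc.intervalIntegrable 0 a)
    (hc.stronglyMeasurableAtFilter _ _) hc.continuousAt).const_sub (gaussTail 0)
  exact h.congr_of_eventuallyEq (.of_forall gaussTail_eq)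

theorem continuous_gaussTail : Continuous gaussTail :=
  continuous_iff_continuousAt.2 fun a => (hasDerivAt_gaussTail a).continuousAt

theorem gaussTail_le {a : ℝ} (ha : 0 ≤ a) : gaussTail a ≤ √Real.pi / 2 := by
  rw [← gaussTail_zero, gaussTail_eq a]
  have : 0 ≤ ∫ θ in (0 : ℝ)..a, Real.exp (-θ ^ 2) :=
    intervalIntegral.integral_nonneg ha fun _ _ => (Real.exp_pos _).le
  linarith

theorem mul_gaussTail_le (a : ℝ) : a * gaussTail a ≤ Real.exp (-a ^ 2) / 2 := by
  have hi : Integrable fun θ : ℝ => θ * Real.exp (-θ ^ 2) := by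
    simpa using integrable_mul_exp_neg_mul_sq one_pos
  have hd : ∀ x ∈ Ici a, HasDerivAt (fun θ : ℝ => -Real.exp (-θ ^ 2) / 2)
      (x * Real.exp (-x ^ 2)) x := by
    intro x _
    have := (((hasDerivAt_pow 2 x).neg).exp.neg).div_const 2
    refine this.congr_deriv ?_
    simp
    ring
  have ht : Tendsto (fun θ : ℝ => -Real.exp (-θ ^ 2) / 2) atTop (𝓝 (-0 / 2)) := by
    refine Tendsto.div_const (Tendsto.neg ?_) 2
    exact Real.tendsto_exp_neg_atTop_nhds_zero.comp (tendsto_pow_atTop two_ne_zero)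
  have h := integral_Ioi_of_hasDerivAt_of_tendsto' hd hi.integrableOn ht
  calc a * gaussTail a = ∫ θ in Ioi a, a * Real.exp (-θ ^ 2) := by
        rw [integral_const_mul, gaussTail]
    _ ≤ ∫ θ in Ioi a, θ * Real.exp (-θ ^ 2) := by
        refine setIntegral_mono_on (integrable_exp_neg_sq.const_mul a).integrableOn
          hi.integrableOn measurableSet_Ioi fun θ hθ => ?_
        have : a < θ := hθ
        gcongr
    _ = Real.exp (-a ^ 2) / 2 := by rw [h]; ring

/-- The integrand of `Iarg`, as a function of `L = β` and `y = x`. For `y > 0` an integration by parts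
turns it into `½ ∫_{√y}^∞ (1 - e^{-L² v²}) / v² dv`. At `y = 0` the quotient is `0 / 0 = 0`, which is
also its limit, so that the function is continuous on `[0, ∞)`. -/
noncomputable def crossover (L y : ℝ) : ℝ :=
  (1 - Real.exp (-L ^ 2 * y)) / (2 * √y) + L * gaussTail (L * √y)

theorem one_sub_exp_nonneg (L : ℝ) {y : ℝ} (hy : 0 ≤ y) : 0 ≤ 1 - Real.exp (-L ^ 2 * y) := by
  have : Real.exp (-L ^ 2 * y) ≤ 1 := Real.exp_le_one_iff.2 (by nlinarith [mul_nonneg (sq_nonneg L) hy])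
  linarith

theorem crossover_nonneg {L y : ℝ} (hL : 0 ≤ L) (hy : 0 ≤ y) : 0 ≤ crossover L y :=
  add_nonneg (div_nonneg (one_sub_exp_nonneg L hy) (by positivity))
    (mul_nonneg hL (gaussTail_nonneg _))

theorem crossover_zero_right (L : ℝ) : crossover L 0 = L * (√Real.pi / 2) := by
  simp [crossover, gaussTail_zero]

theorem crossover_le {L y : ℝ} (hy : 0 < y) : crossover L y ≤ 1 / (2 * √y) := by
  have hs := Real.sqrt_pos.2 hy
  have h := mul_gaussTail_le (L * √y)
  have e : -(L * √y) ^ 2 = -L ^ 2 * y := by rw [mul_pow, Real.sq_sqrt hy.le]; ring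
  rw [e] at h
  have : L * gaussTail (L * √y) ≤ Real.exp (-L ^ 2 * y) / (2 * √y) := by
    rw [le_div_iff₀ (by positivity)]
    linarith
  unfold crossover
  rw [sub_div]
  linarith

theorem hasDerivAt_gaussTail_mul_sqrt (L : ℝ) {y : ℝ} (hy : 0 < y) :
    HasDerivAt (fun y => gaussTail (L * √y)) (-Real.exp (-L ^ 2 * y) * (L * (1 / (2 * √y)))) y := by
  have h2 := (hasDerivAt_gaussTail (L * √y)).comp y (((Real.hasDerivAt_sqrt hy.ne').const_mul L))
  have e : -(L * √y) ^ 2 = -L ^ 2 * y := by rw [mul_pow, Real.sq_sqrt hy.le]; ring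
  rw [e] at h2
  exact h2

theorem hasDerivAt_exp_mul (L y : ℝ) :
    HasDerivAt (fun y => Real.exp (-L ^ 2 * y)) (-L ^ 2 * Real.exp (-L ^ 2 * y)) y := by
  have := (((hasDerivAt_id y).const_mul (-L ^ 2))).exp
  refine this.congr_deriv ?_
  simp only [id, mul_one]; ring

theorem hasDerivAt_crossover (L : ℝ) {y : ℝ} (hy : 0 < y) :
    HasDerivAt (crossover L) (-(1 - Real.exp (-L ^ 2 * y)) / (4 * (y * √y))) y := by
  have hs := Real.sqrt_pos.2 hy
  have h1 := ((hasDerivAt_exp_mul L y).const_sub 1).div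
    ((Real.hasDerivAt_sqrt hy.ne').const_mul 2) (by positivity)
  have h2 := (hasDerivAt_gaussTail_mul_sqrt L hy).const_mul L
  refine (h1.add h2).congr_deriv ?_
  have e : y = √y ^ 2 := (Real.sq_sqrt hy.le).symm
  set E := Real.exp (-L ^ 2 * y)
  set s := √y
  rw [e]
  field_simp
  ring

theorem continuousOn_crossover {L : ℝ} : ContinuousOn (crossover L) (Ici 0) := by
  have hc : Continuous fun y => L * gaussTail (L * √y) :=
    continuous_const.mul (continuous_gaussTail.comp (continuous_const.mul Real.continuous_sqrt))
  refine ContinuousOn.add (fun y hy => ?_) hc.continuousOn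
  rcases eq_or_lt_of_le (show 0 ≤ y from hy) with rfl | hy'
  · -- near `0` the quotient is squeezed between `0` and `L² √y / 2`
    rw [ContinuousWithinAt]
    simp only [mul_zero, Real.exp_zero, sub_self, Real.sqrt_zero, div_zero]
    have hlim : Tendsto (fun y => L ^ 2 * √y / 2) (𝓝[≥] 0) (𝓝 0) := by
      have : Continuous fun y => L ^ 2 * √y / 2 := by fun_prop
      have := this.tendsto 0
      simp only [Real.sqrt_zero, mul_zero, zero_div] at this
      exact this.mono_left nhdsWithin_le_nhds
    refine tendsto_of_tendsto_of_tendsto_of_le_of_le' tendsto_const_nhds hlim ?_ ?_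
    · filter_upwards [self_mem_nhdsWithin] with y hy
      exact div_nonneg (one_sub_exp_nonneg L hy) (by positivity)
    · filter_upwards [self_mem_nhdsWithin] with y hy
      rcases eq_or_lt_of_le (show 0 ≤ y from hy) with rfl | hy'
      · simp
      have hs := Real.sqrt_pos.2 hy'
      rw [div_le_iff₀ (by positivity)]
      have h1 := Real.add_one_le_exp (-L ^ 2 * y)
      have h2 : √y * √y = y := Real.mul_self_sqrt hy
      calc 1 - Real.exp (-L ^ 2 * y) ≤ L ^ 2 * y := by linarith
        _ = _ := by linear_combination (-L ^ 2) * h2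
  · have hs := Real.sqrt_pos.2 hy'
    refine ContinuousAt.continuousWithinAt (ContinuousAt.div (by fun_prop) (by fun_prop) (by positivity))

/-- Monotonicity on all of `[0, ∞)`, including `0`, allows sums over integers to be compared with
integrals at a cost of `crossover L 0 = O(L)`. -/
theorem antitoneOn_crossover (L : ℝ) : AntitoneOn (crossover L) (Ici 0) := by
  refine antitoneOn_of_deriv_nonpos (convex_Ici 0) continuousOn_crossover ?_ ?_
  · rw [interior_Ici]
    exact fun y hy => (hasDerivAt_crossover L hy).differentiableAt.differentiableWithinAt
  · rw [interior_Ici]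
    intro y hy
    have hy' : 0 < y := hy
    rw [(hasDerivAt_crossover L hy').deriv]
    have := one_sub_exp_nonneg L hy'.le
    exact div_nonpos_of_nonpos_of_nonneg (by linarith) (by positivity)

theorem intervalIntegrable_crossover (L : ℝ) {b : ℝ} (hb : 0 ≤ b) :
    IntervalIntegrable (crossover L) volume 0 b :=
  ((antitoneOn_crossover L).mono (by rw [uIcc_of_le hb]; exact Icc_subset_Ici_self)).intervalIntegrable

theorem Iarg_eq_integral_crossover (β : ℝ) : Iarg β = ∫ x in (0 : ℝ)..1, crossover β x := by
  have hc : Continuous fun y => β * gaussTail (β * √y) :=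
    continuous_const.mul (continuous_gaussTail.comp (continuous_const.mul Real.continuous_sqrt))
  have hi := hc.intervalIntegrable (μ := volume) 0 1
  have h1 : IntervalIntegrable (fun x => (1 - Real.exp (-β ^ 2 * x)) / (2 * √x)) volume 0 1 := by
    refine ((intervalIntegrable_crossover β zero_le_one).sub hi).congr fun x _ => ?_
    simp [crossover]
  unfold crossover
  rw [intervalIntegral.integral_add h1 hi, intervalIntegral.integral_const_mul]
  rfl

/-- The scaling that turns `∫_0^N` of the crossover function at `L` into `√N` times `∫_0^1` at `√N L`. -/
theorem crossover_sqrt_mul {n : ℝ} (hn : 0 < n) (L x : ℝ) :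
    crossover (√n * L) x = √n * crossover L (n * x) := by
  have hs := Real.sqrt_pos.2 hn
  have e1 : -(√n * L) ^ 2 * x = -L ^ 2 * (n * x) := by rw [mul_pow, Real.sq_sqrt hn.le]; ring
  have e2 : √n * L * √x = L * √(n * x) := by rw [Real.sqrt_mul hn.le]; ring
  unfold crossover
  rw [e1, e2, mul_add, Real.sqrt_mul hn.le]
  congr 1
  · rw [← mul_div_assoc, show 2 * (√n * √x) = √n * (2 * √x) by ring, mul_div_mul_left _ _ hs.ne']
  · ring

theorem integral_crossover {N : ℕ} (hN : N ≠ 0) (L : ℝ) :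
    ∫ y in (0 : ℝ)..N, crossover L y = √N * Iarg (√N * L) := by
  have hn : (0 : ℝ) < N := by positivity
  rw [Iarg_eq_integral_crossover]
  simp_rw [crossover_sqrt_mul hn]
  rw [intervalIntegral.integral_const_mul, intervalIntegral.integral_comp_mul_left _ hn.ne',
    smul_eq_mul, mul_zero, mul_one, ← mul_assoc, ← mul_assoc, Real.mul_self_sqrt hn.le,
    mul_inv_cancel₀ hn.ne', one_mul]

theorem abs_sum_crossover_sub_le {N : ℕ} (hN : N ≠ 0) {L : ℝ} (hL : 0 ≤ L) :
    |∑ j ∈ Finset.range N, crossover L (j + 1) - √N * Iarg (√N * L)| ≤ L * (√Real.pi / 2) := by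
  have hanti : AntitoneOn (crossover L) (Icc 0 (0 + (N : ℝ))) :=
    (antitoneOn_crossover L).mono Icc_subset_Ici_self
  have h1 := hanti.sum_le_integral
  have h2 := hanti.integral_le_sum
  simp only [zero_add, integral_crossover hN] at h1 h2
  have h3 : ∑ j ∈ Finset.range N, crossover L j + crossover L N =
      ∑ j ∈ Finset.range N, crossover L (j + 1) + crossover L 0 := by
    have a1 := Finset.sum_range_succ (fun j : ℕ => crossover L j) N
    have a2 := Finset.sum_range_succ' (fun j : ℕ => crossover L j) N
    push_cast at a1 a2
    linarith
  have h4 := crossover_nonneg hL (Nat.cast_nonneg (α := ℝ) N)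
  push_cast at h1
  rw [crossover_zero_right] at h3
  have h5 : 0 ≤ L * (√Real.pi / 2) := by positivity
  rw [abs_le]
  constructor <;> linarith

/-- The boundary terms cancel, leaving only the Gaussian tail. -/
theorem hasDerivAt_crossover_left (β : ℝ) {x : ℝ} (hx : 0 < x) :
    HasDerivAt (fun β => crossover β x) (gaussTail (β * √x)) β := by
  have hs := Real.sqrt_pos.2 hx
  have e : -(β * √x) ^ 2 = -β ^ 2 * x := by rw [mul_pow, Real.sq_sqrt hx.le]; ring
  have h1 := (((((hasDerivAt_pow 2 β).neg).mul_const x).exp).const_sub 1).div_const (2 * √x)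
  have h2 := (hasDerivAt_id β).mul ((hasDerivAt_gaussTail (β * √x)).comp β
    ((hasDerivAt_id β).mul_const √x))
  refine (h1.add h2).congr_deriv ?_
  rw [e]
  simp only [Pi.neg_apply, id, Function.comp_apply, Nat.cast_ofNat]
  have e : x = √x ^ 2 := (Real.sq_sqrt hx.le).symm
  set E := Real.exp (-β ^ 2 * x)
  set G := gaussTail (β * √x)
  set s := √x
  rw [e]
  field_simp
  ring

theorem abs_crossover_sub_le {β β' : ℝ} (h : 0 ≤ β) (h' : 0 ≤ β') {x : ℝ} (hx : 0 < x) :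
    |crossover β x - crossover β' x| ≤ √Real.pi / 2 * |β - β'| := by
  refine (convex_Ici (0 : ℝ)).norm_image_sub_le_of_norm_hasDerivWithin_le
    (f := fun β => crossover β x) (f' := fun β => gaussTail (β * √x))
    (fun b _ => (hasDerivAt_crossover_left b hx).hasDerivWithinAt) (fun b hb => ?_) h' h
  rw [Real.norm_of_nonneg (gaussTail_nonneg _)]
  exact gaussTail_le (mul_nonneg hb (Real.sqrt_nonneg x))

theorem abs_Iarg_sub_le {β β' : ℝ} (h : 0 ≤ β) (h' : 0 ≤ β') :
    |Iarg β - Iarg β'| ≤ √Real.pi / 2 * |β - β'| := by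
  rw [Iarg_eq_integral_crossover, Iarg_eq_integral_crossover,
    ← intervalIntegral.integral_sub (intervalIntegrable_crossover β zero_le_one)
      (intervalIntegrable_crossover β' zero_le_one)]
  have := intervalIntegral.norm_integral_le_of_norm_le_const (a := 0) (b := 1)
    (f := fun x => crossover β x - crossover β' x) (C := √Real.pi / 2 * |β - β'|)
    (fun x hx => abs_crossover_sub_le h h' (by rw [uIoc_of_le zero_le_one] at hx; exact hx.1))
  simpa using this

theorem Iarg_zero : Iarg 0 = 0 := by simp [Iarg]

theorem Iarg_pos {β : ℝ} (h : 0 < β) : 0 < Iarg β := by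
  have h1 : crossover β 1 ≤ Iarg β := by
    rw [Iarg_eq_integral_crossover]
    have := intervalIntegral.integral_mono_on (a := 0) (b := 1) (μ := volume)
      (f := fun _ => crossover β 1) (g := crossover β) zero_le_one (by simp)
      (intervalIntegrable_crossover β zero_le_one)
      (fun x hx => antitoneOn_crossover β hx.1 (mem_Ici.2 zero_le_one) hx.2)
    simpa using this
  refine lt_of_lt_of_le ?_ h1
  have h2 : Real.exp (-β ^ 2 * 1) < 1 := Real.exp_lt_one_iff.2 (by nlinarith)
  refine add_pos_of_pos_of_nonneg (div_pos (by linarith) (by simp)) (mul_nonneg h.le (gaussTail_nonneg _))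

/-- A closed form of `Iarg`, from an explicit primitive of the crossover function in `y`. -/
theorem Iarg_eq {β : ℝ} (h : 0 < β) :
    Iarg β = 1 + gaussTail β / (2 * β) + β * gaussTail β - Real.exp (-β ^ 2) / 2 -
      √Real.pi / (4 * β) := by
  set A : ℝ → ℝ := fun x => √x + gaussTail (β * √x) / (2 * β) + β * (x * gaussTail (β * √x)) -
    √x * Real.exp (-β ^ 2 * x) / 2 with hA
  have hcG : Continuous fun x => gaussTail (β * √x) :=
    continuous_gaussTail.comp (continuous_const.mul Real.continuous_sqrt)
  have hc : Continuous A := by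
    simp only [hA]
    fun_prop
  have hd : ∀ x ∈ Ioo (0 : ℝ) 1, HasDerivAt A (crossover β x) x := by
    intro x hx
    have hs := Real.sqrt_pos.2 hx.1
    have hG := hasDerivAt_gaussTail_mul_sqrt β hx.1
    have hS := Real.hasDerivAt_sqrt hx.1.ne'
    have := ((hS.add (hG.div_const (2 * β))).add (((hasDerivAt_id x).mul hG).const_mul β)).sub
      ((hS.mul (hasDerivAt_exp_mul β x)).div_const 2)
    refine this.congr_deriv ?_
    simp only [id, crossover]
    have e : x = √x ^ 2 := (Real.sq_sqrt hx.1.le).symm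
    set E := Real.exp (-β ^ 2 * x)
    set G := gaussTail (β * √x)
    set s := √x
    rw [e]
    field_simp
    ring
  rw [Iarg_eq_integral_crossover, intervalIntegral.integral_eq_sub_of_hasDerivAt_of_le zero_le_one
    hc.continuousOn hd (intervalIntegrable_crossover β zero_le_one)]
  simp only [hA, Real.sqrt_one, Real.sqrt_zero, mul_zero, mul_one, one_mul, zero_mul, gaussTail_zero]
  field_simp
  ring

theorem abs_Iarg_sub_one_le {β : ℝ} (h : 0 < β) : |Iarg β - 1| ≤ 1 / β := by
  rw [Iarg_eq h]
  have h1 := gaussTail_le h.le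
  have h2 := mul_gaussTail_le β
  have h3 := gaussTail_nonneg β
  have h4 : gaussTail β / (2 * β) ≤ √Real.pi / (4 * β) := by
    calc _ ≤ (√Real.pi / 2) / (2 * β) := by gcongr
      _ = _ := by field_simp; norm_num
  have h5 : √Real.pi / (4 * β) ≤ 1 / (2 * β) := by
    have : √Real.pi ≤ 2 := Real.sqrt_le_iff.2 ⟨by norm_num, by linarith [Real.pi_le_four]⟩
    rw [div_le_div_iff₀ (by positivity) (by positivity)]
    nlinarith
  have h6 : Real.exp (-β ^ 2) / 2 ≤ 1 / (2 * β) := by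
    rw [div_le_div_iff₀ (by positivity) (by positivity), Real.exp_neg]
    have := Real.add_one_le_exp (β ^ 2)
    have h7 : (Real.exp (β ^ 2))⁻¹ * β ≤ 1 := by
      rw [inv_mul_le_iff₀ (Real.exp_pos _)]
      nlinarith [sq_nonneg (β - 1)]
    linarith
  have h7 : 1 / β = 1 / (2 * β) + 1 / (2 * β) := by field_simp; norm_num
  have h8 : 0 ≤ gaussTail β / (2 * β) := by positivity
  have h9 : 0 ≤ β * gaussTail β := by positivity
  have h10 : 0 < 1 / (2 * β) := by positivity
  rw [h7, abs_le]
  constructor <;> linarith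

/-! ### Poisson summation for the Fourier modes -/

open HurwitzZeta

theorem exp_neg_le_inv {y : ℝ} (hy : 0 < y) : Real.exp (-y) ≤ 1 / y := by
  rw [Real.exp_neg, ← one_div]
  exact one_div_le_one_div_of_le hy (by linarith [Real.add_one_le_exp y])

/-- In the periodized Gaussian `∑_n e^{-π (n + a)² s}` with `a` at distance at least `δ` from `1`, all
terms except `n = 0` are negligible. -/
theorem evenKernel_sub_mem_Icc {a s δ : ℝ} (hs : 0 < s) (hδ : 0 < δ) (ha : 0 ≤ a)
    (haδ : a ≤ 1 - δ) :
    evenKernel (a : UnitAddCircle) s - Real.exp (-Real.pi * a ^ 2 * s) ∈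
      Icc 0 (4 / (Real.pi * δ ^ 2 * s)) := by
  have hpi := Real.pi_pos
  have h := (hasSum_int_evenKernel a hs).nat_add_neg
  have h' := (hasSum_nat_add_iff' 1).2 h
  simp only [Finset.range_one, Finset.sum_singleton, Nat.cast_zero, Int.cast_zero, neg_zero,
    zero_add] at h'
  have hval : evenKernel (a : UnitAddCircle) s + Real.exp (-Real.pi * a ^ 2 * s) -
      (Real.exp (-Real.pi * a ^ 2 * s) + Real.exp (-Real.pi * a ^ 2 * s)) =
      evenKernel (a : UnitAddCircle) s - Real.exp (-Real.pi * a ^ 2 * s) := by ring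
  rw [hval] at h'
  -- all nonzero integers `n` satisfy `|n + a| ≥ δ |n|`
  have hterm : ∀ (k : ℕ) (u : ℝ), δ * (1 + k) ≤ |u| →
      Real.exp (-Real.pi * u ^ 2 * s) ≤ 1 / (Real.pi * δ ^ 2 * s) * (1 / (1 + (k : ℝ)) ^ 2) := by
    intro k u hu
    have hu2 : (δ * (1 + k)) ^ 2 ≤ u ^ 2 := by
      rw [← sq_abs u]
      gcongr
    have : 0 < u ^ 2 := lt_of_lt_of_le (by positivity) hu2
    rw [show -Real.pi * u ^ 2 * s = -(Real.pi * u ^ 2 * s) by ring]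
    refine (exp_neg_le_inv (by positivity)).trans ?_
    calc 1 / (Real.pi * u ^ 2 * s) ≤ 1 / (Real.pi * (δ * (1 + k)) ^ 2 * s) := by gcongr
      _ = _ := by field_simp
  refine ⟨h'.nonneg fun k => by positivity, ?_⟩
  rw [← h'.tsum_eq]
  refine Real.tsum_le_of_sum_range_le (fun k => by positivity) fun M => ?_
  calc _ ≤ ∑ k ∈ Finset.range M, 2 / (Real.pi * δ ^ 2 * s) * (1 / (1 + (k : ℝ)) ^ 2) := by
        refine Finset.sum_le_sum fun k _ => ?_
        have hk : (0 : ℝ) ≤ k := k.cast_nonneg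
        have a1 := hterm k (((k + 1 : ℕ) : ℤ) + a) (by
          rw [abs_of_nonneg (by positivity)]; push_cast; nlinarith)
        have a2 := hterm k ((-((k + 1 : ℕ) : ℤ) : ℤ) + a) (by
          rw [abs_of_nonpos (by push_cast; linarith)]; push_cast; nlinarith)
        refine (add_le_add a1 a2).trans (le_of_eq (by ring))
    _ ≤ 2 / (Real.pi * δ ^ 2 * s) * (2 / 1) := by
        rw [← Finset.mul_sum]
        gcongr
        exact sum_one_div_add_sq_le le_rfl M
    _ = _ := by ring

/-- The difference at `0` and at `L` of the heat kernel `∑_{m ∈ ℤ} e^{-t m²} cos (m L)` of the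
circle. -/
noncomputable def heatDiff (L t : ℝ) : ℝ :=
  cosKernel ((0 : ℝ) : UnitAddCircle) (t / Real.pi) -
    cosKernel ((L / (2 * Real.pi) : ℝ) : UnitAddCircle) (t / Real.pi)

theorem hasSum_heatDiff (L : ℝ) {t : ℝ} (ht : 0 < t) :
    HasSum (fun k : ℕ => 2 * (1 - Real.cos ((k + 1 : ℕ) * L)) *
      Real.exp (-t * ((k + 1 : ℕ) : ℝ) ^ 2)) (heatDiff L t) := by
  have hpi := Real.pi_pos
  have hs : 0 < t / Real.pi := by positivity
  have h := (hasSum_nat_cosKernel₀ 0 hs).sub (hasSum_nat_cosKernel₀ (L / (2 * Real.pi)) hs)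
  convert! h using 1
  · ext k
    have e1 : 2 * Real.pi * (L / (2 * Real.pi)) * ((k : ℝ) + 1) = (k + 1 : ℕ) * L := by
      push_cast; field_simp
    have e2 : -Real.pi * ((k : ℝ) + 1) ^ 2 * (t / Real.pi) = -t * ((k + 1 : ℕ) : ℝ) ^ 2 := by
      push_cast; field_simp
    rw [e1, e2]
    simp
    ring
  · unfold heatDiff; ring

theorem continuousOn_heatDiff (L : ℝ) : ContinuousOn (heatDiff L) (Ioi 0) := by
  have h : MapsTo (fun t : ℝ => t / Real.pi) (Ioi 0) (Ioi 0) := fun t ht => div_pos ht Real.pi_pos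
  have hc : ContinuousOn (fun t : ℝ => t / Real.pi) (Ioi 0) := by fun_prop
  exact ((continuousOn_cosKernel _).comp hc h).sub ((continuousOn_cosKernel _).comp hc h)

/-- Short-time asymptotics of the heat kernel difference: by Poisson summation (the functional
equation of the theta kernel) only the images at distance `0` and `L` contribute. The bound
degenerates as `L` approaches `2π`, where the image at distance `2π - L` enters. -/
theorem abs_heatDiff_sub_le {L t δ : ℝ} (ht : 0 < t) (ht1 : t ≤ 1) (hδ : 0 < δ) (hδ1 : δ ≤ 1)
    (hL : 0 ≤ L) (hLδ : L ≤ 2 * Real.pi * (1 - δ)) :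
    |heatDiff L t - √(Real.pi / t) * (1 - Real.exp (-(L ^ 2 / (4 * t))))| ≤ 4 / δ ^ 2 := by
  have hpi := Real.pi_pos
  set s := Real.pi / t with hs
  have hs1 : 1 ≤ s := by
    rw [hs, le_div_iff₀ ht]; linarith [Real.pi_gt_three]
  have hs0 : 0 < s := by linarith
  have hfe : ∀ a : UnitAddCircle, cosKernel a (t / Real.pi) = √s * evenKernel a s := by
    intro a
    rw [evenKernel_functional_equation, hs, one_div_div, ← Real.sqrt_eq_rpow, ← mul_assoc,
      mul_one_div_cancel (Real.sqrt_pos.2 hs0).ne', one_mul]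
  have hx1 : L / (2 * Real.pi) ≤ 1 - δ := by
    rw [div_le_iff₀ (by positivity)]; linarith
  obtain ⟨l0, u0⟩ := evenKernel_sub_mem_Icc (a := 0) hs0 hδ le_rfl (by linarith)
  obtain ⟨l1, u1⟩ := evenKernel_sub_mem_Icc (a := L / (2 * Real.pi)) hs0 hδ (by positivity) hx1
  have e1 : -Real.pi * (L / (2 * Real.pi)) ^ 2 * s = -(L ^ 2 / (4 * t)) := by
    rw [hs]; field_simp; norm_num
  rw [e1] at l1 u1
  simp only [ne_eq, OfNat.ofNat_ne_zero, not_false_eq_true, zero_pow, mul_zero, zero_mul,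
    Real.exp_zero] at l0 u0
  rw [heatDiff, hfe, hfe, ← mul_sub, ← mul_sub, abs_mul, abs_of_nonneg (Real.sqrt_nonneg s)]
  have habs : |evenKernel ((0 : ℝ) : UnitAddCircle) s -
      evenKernel ((L / (2 * Real.pi) : ℝ) : UnitAddCircle) s -
      (1 - Real.exp (-(L ^ 2 / (4 * t))))| ≤ 4 / (Real.pi * δ ^ 2 * s) := by
    rw [abs_le]; constructor <;> linarith
  calc _ ≤ √s * (4 / (Real.pi * δ ^ 2 * s)) := by gcongr
    _ ≤ s * (4 / (1 * δ ^ 2 * s)) := by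
        gcongr
        · exact Real.sqrt_le_self_iff.2 (Or.inr hs1)
        · linarith [Real.pi_gt_three]
    _ = 4 / δ ^ 2 := by field_simp

/-- Integrating `e^{-t m²}` over `0 < t ≤ 1 / (4J)` produces `(1 - e^{-m²/(4J)}) / m²`. -/
theorem blockVariance_eq_integral (L : ℝ) {J : ℝ} (hJ : 0 < J) :
    blockVariance L J =
      1 / (2 * Real.pi ^ 2) * ∫ t in Ioc 0 (1 / (4 * J)), heatDiff L t := by
  have hpi := Real.pi_pos
  set τ := 1 / (4 * J) with hτ
  have hτ0 : 0 < τ := by positivity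
  set F : ℕ → ℝ → ℝ := fun k t => 2 * (1 - Real.cos ((k + 1 : ℕ) * L)) *
      Real.exp (-t * ((k + 1 : ℕ) : ℝ) ^ 2) with hF
  have hF0 : ∀ k t, 0 ≤ F k t := fun k t =>
    mul_nonneg (by linarith [Real.cos_le_one ((k + 1 : ℕ) * L)]) (Real.exp_pos _).le
  have hFc : ∀ k, Continuous (F k) := fun k => by simp only [hF]; fun_prop
  have hFi : ∀ k, Integrable (F k) (volume.restrict (Ioc 0 τ)) := fun k =>
    ((hFc k).intervalIntegrable 0 τ).1
  have hint : ∀ k, ∫ t in Ioc 0 τ, F k t = 2 * Real.pi ^ 2 * (2 * arcWeight L (k + 1) *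
      (1 - Real.exp (-(((k + 1 : ℕ) : ℝ) ^ 2 / (4 * J))))) := by
    intro k
    have hm : (0 : ℝ) < (k + 1 : ℕ) := by positivity
    rw [← intervalIntegral.integral_of_le hτ0.le]
    set m : ℝ := ((k + 1 : ℕ) : ℝ) with hmdef
    have hd : ∀ t ∈ uIcc 0 τ, HasDerivAt
        (fun t => 2 * (1 - Real.cos (m * L)) * (-(Real.exp (-t * m ^ 2) / m ^ 2))) (F k t) t := by
      intro t _
      have := ((((((hasDerivAt_id t).neg).mul_const (m ^ 2)).exp).div_const (m ^ 2)).neg).const_mul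
        (2 * (1 - Real.cos (m * L)))
      refine this.congr_deriv ?_
      simp only [hF, ← hmdef, Pi.neg_apply, id]
      field_simp
    rw [intervalIntegral.integral_eq_sub_of_hasDerivAt hd ((hFc k).intervalIntegrable 0 τ)]
    have e : -τ * m ^ 2 = -(m ^ 2 / (4 * J)) := by rw [hτ]; ring
    simp only [e, neg_zero, zero_mul, Real.exp_zero, arcWeight, ← hmdef]
    field_simp
    ring
  have hsum : Summable fun k => ∫ t in Ioc 0 τ, ‖F k t‖ := by
    have : ∀ k, ∫ t in Ioc 0 τ, ‖F k t‖ = 2 * Real.pi ^ 2 * (2 * arcWeight L (k + 1) *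
      (1 - Real.exp (-(((k + 1 : ℕ) : ℝ) ^ 2 / (4 * J))))) := by
      intro k
      rw [← hint k]
      congr 1; ext t
      exact Real.norm_of_nonneg (hF0 k t)
    simp_rw [this]
    refine Summable.mul_left _ (Summable.of_nonneg_of_le (fun k => ?_) (fun k => ?_)
      ((summable_arcWeight L).mul_left 2))
    · have : Real.exp (-(((k + 1 : ℕ) : ℝ) ^ 2 / (4 * J))) ≤ 1 :=
        Real.exp_le_one_iff.2 (neg_nonpos.2 (by positivity))
      exact mul_nonneg (mul_nonneg two_pos.le (arcWeight_nonneg _ _)) (by linarith)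
    · exact mul_le_of_le_one_right (mul_nonneg two_pos.le (arcWeight_nonneg _ _))
        (by linarith [Real.exp_pos (-(((k + 1 : ℕ) : ℝ) ^ 2 / (4 * J)))])
  have h := integral_tsum_of_summable_integral_norm hFi hsum
  simp_rw [hint] at h
  rw [tsum_mul_left] at h
  have hH : ∫ t in Ioc 0 τ, ∑' k, F k t = ∫ t in Ioc 0 τ, heatDiff L t :=
    setIntegral_congr_fun measurableSet_Ioc fun t ht => (hasSum_heatDiff L ht.1).tsum_eq
  rw [← hH, ← h, blockVariance]
  field_simp

theorem intervalIntegrable_heatMain (L : ℝ) {τ : ℝ} (hτ : 0 < τ) :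
    IntervalIntegrable (fun t => √(Real.pi / t) * (1 - Real.exp (-(L ^ 2 / (4 * t))))) volume 0 τ := by
  have h := (intervalIntegral.intervalIntegrable_rpow' (a := 0) (b := τ) (r := -(1 / 2))
    (by norm_num)).const_mul (√Real.pi)
  refine h.mono_fun (Measurable.aestronglyMeasurable (by fun_prop)) ?_
  refine (ae_restrict_iff' measurableSet_uIoc).2 (.of_forall fun t ht => ?_)
  rw [uIoc_of_le hτ.le] at ht
  have ht0 := ht.1
  have h1 : Real.exp (-(L ^ 2 / (4 * t))) ≤ 1 := Real.exp_le_one_iff.2 (neg_nonpos.2 (by positivity))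
  have h2 := Real.exp_pos (-(L ^ 2 / (4 * t)))
  beta_reduce
  rw [Real.norm_of_nonneg (mul_nonneg (Real.sqrt_nonneg _) (by linarith)),
    Real.norm_of_nonneg (by positivity), Real.rpow_neg ht0.le, ← Real.sqrt_eq_rpow,
    Real.sqrt_div' _ ht0.le, ← div_eq_mul_inv]
  exact mul_le_of_le_one_right (by positivity) (by linarith)

/-- The primitive is `2 √π · crossover L (1 / (4t))`, which vanishes as `t → 0⁺`. -/
theorem integral_heatMain {L J : ℝ} (hL : 0 ≤ L) (hJ : 0 < J) :
    ∫ t in (0 : ℝ)..(1 / (4 * J)), √(Real.pi / t) * (1 - Real.exp (-(L ^ 2 / (4 * t)))) =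
      2 * √Real.pi * crossover L J := by
  have hτ : 0 < 1 / (4 * J) := by positivity
  have hsqrt : ∀ t : ℝ, 0 < t → √(1 / (4 * t)) = 1 / (2 * √t) := by
    intro t ht
    rw [Real.sqrt_div' _ (by positivity), Real.sqrt_one, Real.sqrt_mul (by norm_num),
      show (4 : ℝ) = 2 ^ 2 by norm_num, Real.sqrt_sq (by norm_num)]
  have hd : ∀ t : ℝ, 0 < t → HasDerivAt (fun t => 2 * √Real.pi * crossover L (1 / (4 * t)))
      (√(Real.pi / t) * (1 - Real.exp (-(L ^ 2 / (4 * t))))) t := by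
    intro t ht
    have hy : 0 < 1 / (4 * t) := by positivity
    have h1 : HasDerivAt (fun t : ℝ => 1 / (4 * t)) (-(1 / (4 * t ^ 2))) t := by
      have := (((hasDerivAt_id t).const_mul 4).inv (by simp; exact ht.ne'))
      refine (this.congr_of_eventuallyEq (.of_forall fun t => one_div _)).congr_deriv ?_
      simp only [id]
      field_simp
    have h2 := ((hasDerivAt_crossover L hy).comp t h1).const_mul (2 * √Real.pi)
    refine h2.congr_deriv ?_
    have hs := Real.sqrt_pos.2 ht
    have e1 := hsqrt t ht
    have e2 : -L ^ 2 * (1 / (4 * t)) = -(L ^ 2 / (4 * t)) := by ring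
    rw [e1, e2, Real.sqrt_div' _ ht.le]
    have e : t = √t ^ 2 := (Real.sq_sqrt ht.le).symm
    set E := Real.exp (-(L ^ 2 / (4 * t)))
    set s := √t
    rw [e]
    field_simp
    ring
  have h0 : Tendsto (fun t => 2 * √Real.pi * crossover L (1 / (4 * t))) (𝓝[>] 0) (𝓝 0) := by
    have hlim : Tendsto (fun t : ℝ => 2 * √Real.pi * √t) (𝓝[>] 0) (𝓝 0) := by
      have : Continuous fun t : ℝ => 2 * √Real.pi * √t := by fun_prop
      have := this.tendsto 0
      simp only [Real.sqrt_zero, mul_zero] at this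
      exact this.mono_left nhdsWithin_le_nhds
    refine tendsto_of_tendsto_of_tendsto_of_le_of_le' tendsto_const_nhds hlim ?_ ?_
    · filter_upwards [self_mem_nhdsWithin] with t ht
      have ht' : 0 < t := ht
      exact mul_nonneg (by positivity) (crossover_nonneg hL (by positivity))
    · filter_upwards [self_mem_nhdsWithin] with t ht
      have ht' : 0 < t := ht
      have hs := Real.sqrt_pos.2 ht'
      have e1 := hsqrt t ht'
      have := crossover_le (L := L) (y := 1 / (4 * t)) (by positivity)
      rw [e1] at this
      gcongr
      refine this.trans (le_of_eq ?_)
      field_simp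
  have hb : Tendsto (fun t => 2 * √Real.pi * crossover L (1 / (4 * t))) (𝓝[<] (1 / (4 * J)))
      (𝓝 (2 * √Real.pi * crossover L J)) := by
    have := (hd _ hτ).continuousAt.tendsto
    rw [show 1 / (4 * (1 / (4 * J))) = J by field_simp] at this
    exact this.mono_left nhdsWithin_le_nhds
  rw [intervalIntegral.integral_eq_sub_of_hasDerivAt_of_tendsto hτ (fun t ht => hd t ht.1)
    (intervalIntegrable_heatMain L hτ) h0 hb, sub_zero]

theorem pi_rpow_three_halves : Real.pi ^ (3 / 2 : ℝ) = Real.pi * √Real.pi := by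
  rw [show (3 / 2 : ℝ) = 1 + 1 / 2 by norm_num, Real.rpow_add Real.pi_pos, Real.rpow_one,
    ← Real.sqrt_eq_rpow]

theorem abs_blockVariance_sub_crossover_le {L J δ : ℝ} (hJ : 1 ≤ J) (hδ : 0 < δ) (hδ1 : δ ≤ 1)
    (hL : 0 ≤ L) (hLδ : L ≤ 2 * Real.pi * (1 - δ)) :
    |blockVariance L J - crossover L J / Real.pi ^ (3 / 2 : ℝ)| ≤ 1 / (δ ^ 2 * J) := by
  have hpi := Real.pi_pos
  have hJ0 : 0 < J := by linarith
  set τ := 1 / (4 * J) with hτ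
  have hτ0 : 0 < τ := by positivity
  have hτ1 : τ ≤ 1 := by rw [hτ, div_le_one (by positivity)]; linarith
  have hb : ∀ t ∈ Ioc 0 τ, ‖heatDiff L t - √(Real.pi / t) * (1 - Real.exp (-(L ^ 2 / (4 * t))))‖ ≤
      4 / δ ^ 2 := fun t ht => abs_heatDiff_sub_le ht.1 (ht.2.trans hτ1) hδ hδ1 hL hLδ
  have hmain : IntegrableOn (fun t => √(Real.pi / t) * (1 - Real.exp (-(L ^ 2 / (4 * t)))))
      (Ioc 0 τ) := (intervalIntegrable_heatMain L hτ0).1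
  have hmeas : AEStronglyMeasurable (fun t => heatDiff L t -
      √(Real.pi / t) * (1 - Real.exp (-(L ^ 2 / (4 * t))))) (volume.restrict (Ioc 0 τ)) :=
    (((continuousOn_heatDiff L).mono fun t ht => ht.1).aestronglyMeasurable
      measurableSet_Ioc).sub hmain.aestronglyMeasurable
  have hdiff : IntegrableOn (fun t => heatDiff L t -
      √(Real.pi / t) * (1 - Real.exp (-(L ^ 2 / (4 * t))))) (Ioc 0 τ) :=
    Integrable.of_bound hmeas _
      ((ae_restrict_iff' measurableSet_Ioc).2 (.of_forall hb))
  have hsplit : ∫ t in Ioc 0 τ, heatDiff L t = (∫ t in Ioc 0 τ, (heatDiff L t -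
      √(Real.pi / t) * (1 - Real.exp (-(L ^ 2 / (4 * t)))))) + 2 * √Real.pi * crossover L J := by
    rw [← integral_heatMain hL hJ0, ← hτ, intervalIntegral.integral_of_le hτ0.le,
      ← integral_add hdiff hmain]
    congr 1; ext t; ring
  have hD := norm_setIntegral_le_of_norm_le_const (μ := volume) (s := Ioc 0 τ) (by simp) hb
  rw [Real.volume_real_Ioc_of_le hτ0.le, sub_zero, Real.norm_eq_abs] at hD
  rw [blockVariance_eq_integral L hJ0, hsplit]
  have hs := Real.sqrt_pos.2 hpi
  have hcancel : 1 / (2 * Real.pi ^ 2) * (2 * √Real.pi * crossover L J) =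
      crossover L J / Real.pi ^ (3 / 2 : ℝ) := by
    rw [pi_rpow_three_halves]
    have e : Real.pi = √Real.pi ^ 2 := (Real.sq_sqrt hpi.le).symm
    set s := √Real.pi
    rw [e]
    field_simp
  rw [mul_add, hcancel, add_sub_cancel_right, abs_mul, abs_of_nonneg (by positivity)]
  calc _ ≤ 1 / (2 * Real.pi ^ 2) * (4 / δ ^ 2 * τ) := by gcongr
    _ ≤ 1 * (4 / δ ^ 2 * τ) := by
        gcongr
        rw [div_le_one (by positivity)]
        nlinarith [Real.pi_gt_three]
    _ = _ := by rw [hτ]; field_simp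

/-! ### Uniform estimates of the variance -/

theorem angularVariance_congr (N : ℕ) {a b a' b' : ℝ} (ha : -Real.pi ≤ a) (hab : a ≤ b)
    (hb : b ≤ Real.pi) (ha' : -Real.pi ≤ a') (hab' : a' ≤ b') (hb' : b' ≤ Real.pi)
    (h : b - a = b' - a') : angularVariance N a b = angularVariance N a' b' := by
  rw [angularVariance_eq N ha hab hb, angularVariance_eq N ha' hab' hb', h]

/-- The estimate uniform in `N` and in arc lengths bounded away from `2π`. -/
theorem abs_angularVariance_sub_Iarg_le {N : ℕ} (hN : N ≠ 0) {L δ : ℝ} (hδ : 0 < δ) (hδ1 : δ ≤ 1)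
    (hL : 0 ≤ L) (hLδ : L ≤ 2 * Real.pi * (1 - δ)) :
    |angularVariance N (-(L / 2)) (L / 2) -
      √(N : ℝ) * (1 / Real.pi ^ (3 / 2 : ℝ)) * Iarg (√(N : ℝ) * L)| ≤
      (1285 + 1 / δ ^ 2) * (1 + Real.log N) := by
  have hpi := Real.pi_pos
  have hL2 : L ≤ 2 * Real.pi := by nlinarith
  have h1 := abs_angularVariance_sub_sum_blockVariance_le N (a := -(L / 2)) (b := L / 2)
    (by linarith) (by linarith) (by linarith)
  rw [show L / 2 - -(L / 2) = L by ring] at h1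
  have hP : (1 : ℝ) ≤ Real.pi ^ (3 / 2 : ℝ) :=
    Real.one_le_rpow (by linarith [Real.pi_gt_three]) (by norm_num)
  have h2 : |∑ j ∈ Finset.range N, blockVariance L (j + 1) -
      (∑ j ∈ Finset.range N, crossover L (j + 1)) / Real.pi ^ (3 / 2 : ℝ)| ≤
      1 / δ ^ 2 * (1 + Real.log N) := by
    rw [Finset.sum_div, ← Finset.sum_sub_distrib]
    refine (Finset.abs_sum_le_sum_abs _ _).trans ((Finset.sum_le_sum fun j _ =>
      abs_blockVariance_sub_crossover_le (by linarith [Nat.cast_nonneg (α := ℝ) j]) hδ hδ1 hL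
        hLδ).trans ?_)
    calc _ = 1 / δ ^ 2 * ∑ j ∈ Finset.range N, 1 / ((j : ℝ) + 1) := by
          rw [Finset.mul_sum]
          exact Finset.sum_congr rfl fun j _ => by rw [one_div_mul_one_div]
      _ ≤ _ := by
          gcongr
          exact sum_inv_le_one_add_log N
  have h3 : |(∑ j ∈ Finset.range N, crossover L (j + 1)) / Real.pi ^ (3 / 2 : ℝ) -
      √(N : ℝ) * (1 / Real.pi ^ (3 / 2 : ℝ)) * Iarg (√(N : ℝ) * L)| ≤ 1 := by
    have e : (∑ j ∈ Finset.range N, crossover L (j + 1)) / Real.pi ^ (3 / 2 : ℝ) -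
      √(N : ℝ) * (1 / Real.pi ^ (3 / 2 : ℝ)) * Iarg (√(N : ℝ) * L) =
      (∑ j ∈ Finset.range N, crossover L (j + 1) - √(N : ℝ) * Iarg (√(N : ℝ) * L)) /
        Real.pi ^ (3 / 2 : ℝ) := by ring
    rw [e, abs_div, abs_of_pos (by linarith : 0 < Real.pi ^ (3 / 2 : ℝ)), div_le_one (by linarith)]
    refine (abs_sum_crossover_sub_le hN hL).trans ?_
    rw [pi_rpow_three_halves]
    calc L * (√Real.pi / 2) ≤ 2 * Real.pi * (√Real.pi / 2) := by gcongr
      _ = _ := by ring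
  have hlog : 0 ≤ Real.log N := Real.log_natCast_nonneg N
  rw [abs_le] at *
  constructor <;> linarith [h1.1, h1.2, h2.1, h2.2, h3.1, h3.2]

/-- Each row of gamma ratios has an effective width of order `√N`. -/
theorem sum_gammaRatio_le {N i M : ℕ} (hM : i + M < N) :
    ∑ k ∈ Finset.range M, gammaRatio i (i + (k + 1)) ≤ 16 * √(N : ℝ) := by
  have hN : (1 : ℝ) ≤ N := by exact_mod_cast (by omega : 1 ≤ N)
  set a := √(N : ℝ) with ha
  have ha2 : a ^ 2 = N := Real.sq_sqrt (by linarith)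
  have ha1 : 1 ≤ a := Real.one_le_sqrt.2 hN
  have hterm : ∀ k ∈ Finset.range M, gammaRatio i (i + (k + 1)) ≤
      8 * a ^ 2 * (1 / (a + 1 + k) ^ 2) := by
    intro k hk
    have hkM := Finset.mem_range.1 hk
    obtain ⟨m, hm⟩ : ∃ m : ℝ, m = ((k + 1 : ℕ) : ℝ) := ⟨_, rfl⟩
    have hm1 : 1 ≤ m := by rw [hm]; push_cast; linarith [Nat.cast_nonneg (α := ℝ) k]
    have him : (i : ℝ) + m ≤ a ^ 2 := by
      rw [hm, ha2]; exact_mod_cast (by omega : i + (k + 1) ≤ N)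
    have hi0 : (0 : ℝ) ≤ i := i.cast_nonneg
    have hnum : 0 ≤ m ^ 2 - 1 := by nlinarith
    have h1 := gammaRatio_le_exp i (k + 1)
    rw [← hm] at h1
    have h2 : (m ^ 2 - 1) / (4 * a ^ 2) ≤ (m ^ 2 - 1) / (4 * (i + m)) :=
      div_le_div_of_nonneg_left hnum (by linarith) (by linarith)
    have h3 : (a + m) ^ 2 / (8 * a ^ 2) ≤ Real.exp ((m ^ 2 - 1) / (4 * (i + m))) := by
      refine le_trans ?_ (Real.add_one_le_exp _)
      refine le_trans ?_ (add_le_add_left h2 1)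
      rw [div_add_one (by positivity), div_le_div_iff₀ (by positivity) (by positivity)]
      have : 0 ≤ a ^ 2 := by positivity
      nlinarith [sq_nonneg (a - m)]
    rw [show a + 1 + (k : ℝ) = a + m by rw [hm]; push_cast; ring]
    refine h1.trans ?_
    rw [Real.exp_neg]
    calc _ ≤ ((a + m) ^ 2 / (8 * a ^ 2))⁻¹ := inv_anti₀ (by positivity) h3
      _ = _ := by rw [inv_div]; ring
  refine (Finset.sum_le_sum hterm).trans ?_
  rw [← Finset.mul_sum]
  calc _ ≤ 8 * a ^ 2 * (2 / (a + 1)) := by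
        gcongr
        exact sum_one_div_add_sq_le (by linarith) M
    _ ≤ 8 * a ^ 2 * (2 / a) := by gcongr; linarith
    _ = 16 * a := by field_simp; norm_num

/-- For arcs much shorter than `1 / √N` the count is nearly Poissonian: its variance is close to its mean. -/
theorem abs_angularVariance_sub_mean_le (N : ℕ) {L : ℝ} (hL : 0 ≤ L) (hL2 : L ≤ 2 * Real.pi) :
    |angularVariance N (-(L / 2)) (L / 2) - N * L / (2 * Real.pi)| ≤
      (N * L / (2 * Real.pi)) * (L + 6 * (√(N : ℝ) * L)) := by
  have hpi := Real.pi_gt_three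
  rw [angularVariance_eq N (by linarith) (by linarith) (by linarith),
    show L / 2 - -(L / 2) = L by ring]
  set R := ∑ i ∈ Finset.range N, ∑ k ∈ Finset.range (N - (i + 1)),
        arcWeight L (k + 1) * gammaRatio i (i + (k + 1)) with hR
  have hR0 : 0 ≤ R := Finset.sum_nonneg fun i _ => Finset.sum_nonneg fun k _ =>
    mul_nonneg (arcWeight_nonneg _ _) (gammaRatio_nonneg _ _)
  have hR1 : R ≤ N * (L ^ 2 / (4 * Real.pi ^ 2) * (16 * √(N : ℝ))) := by
    calc R ≤ ∑ i ∈ Finset.range N, L ^ 2 / (4 * Real.pi ^ 2) * (16 * √(N : ℝ)) := by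
          refine Finset.sum_le_sum fun i hi => ?_
          have := Finset.mem_range.1 hi
          calc _ ≤ ∑ k ∈ Finset.range (N - (i + 1)),
                L ^ 2 / (4 * Real.pi ^ 2) * gammaRatio i (i + (k + 1)) :=
                Finset.sum_le_sum fun k _ => mul_le_mul_of_nonneg_right (arcWeight_le_sq _ _)
                  (gammaRatio_nonneg _ _)
            _ ≤ _ := by
                rw [← Finset.mul_sum]
                gcongr
                exact sum_gammaRatio_le (by omega)
      _ = _ := by simp
  set n : ℝ := (N : ℝ)
  have hn : 0 ≤ n := Nat.cast_nonneg _
  have hs : 0 ≤ √n := Real.sqrt_nonneg _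
  have e : n * (L / (2 * Real.pi) - L ^ 2 / (4 * Real.pi ^ 2)) - 2 * R - n * L / (2 * Real.pi) =
      -(n * L ^ 2 / (4 * Real.pi ^ 2) + 2 * R) := by ring
  rw [e, abs_neg, abs_of_nonneg (by positivity)]
  have h1 : n * L ^ 2 / (4 * Real.pi ^ 2) + 2 * R ≤
      n * L ^ 2 / (2 * Real.pi) * (1 / (2 * Real.pi) + 16 * √n / Real.pi) := by
    have : n * L ^ 2 / (2 * Real.pi) * (1 / (2 * Real.pi) + 16 * √n / Real.pi) =
      n * L ^ 2 / (4 * Real.pi ^ 2) + 2 * (n * (L ^ 2 / (4 * Real.pi ^ 2) * (16 * √n))) := by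
      field_simp
      ring
    linarith
  have h2 : 1 / (2 * Real.pi) ≤ 1 := by rw [div_le_one (by positivity)]; linarith
  have h3 : 16 * √n / Real.pi ≤ 6 * √n := by rw [div_le_iff₀ (by positivity)]; nlinarith
  calc _ ≤ n * L ^ 2 / (2 * Real.pi) * (1 + 6 * √n) := h1.trans (by gcongr)
    _ = _ := by ring

/-! ### Asymptotic regimes -/

theorem one_add_log_isBigO :
    (fun N : ℕ => 1 + Real.log (N : ℝ)) =O[atTop] fun N : ℕ => Real.log (N : ℝ) := by
  have h := (tendsto_norm_atTop_atTop.comp Real.tendsto_log_atTop).comp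
    (tendsto_natCast_atTop_atTop (R := ℝ))
  exact ((isLittleO_const_left.2 (Or.inr h)).isBigO).add (isBigO_refl _ _)

theorem log_isLittleO_sqrt :
    (fun N : ℕ => Real.log (N : ℝ)) =o[atTop] fun N : ℕ => √(N : ℝ) := by
  have h := (isLittleO_log_rpow_atTop (r := 1 / 2) (by norm_num)).comp_tendsto
    (tendsto_natCast_atTop_atTop (R := ℝ))
  refine h.congr (fun _ => rfl) fun N => ?_
  simp [Real.sqrt_eq_rpow]

theorem angularVariance_sub_Iarg_isBigO {δ : ℝ} (hδ : 0 < δ) (hδ1 : δ ≤ 1) {α : ℕ → ℝ}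
    (h0 : ∀ᶠ N in atTop, 0 ≤ α N) (h1 : ∀ᶠ N in atTop, α N ≤ 2 * Real.pi * (1 - δ)) :
    (fun N : ℕ => angularVariance N (-(α N / 2)) (α N / 2) -
      √(N : ℝ) * (1 / Real.pi ^ (3 / 2 : ℝ)) * Iarg (√(N : ℝ) * α N))
      =O[atTop] fun N : ℕ => Real.log (N : ℝ) := by
  refine IsBigO.trans (IsBigO.of_bound (1285 + 1 / δ ^ 2) ?_) one_add_log_isBigO
  filter_upwards [h0, h1, eventually_ne_atTop 0] with N a b hN
  rw [Real.norm_of_nonneg (by linarith [Real.log_natCast_nonneg N] : 0 ≤ 1 + Real.log (N : ℝ))]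
  exact abs_angularVariance_sub_Iarg_le hN hδ hδ1 a b

theorem angularVariance_fixed_arc {α : ℝ} (h0 : 0 < α) (h1 : α < 2 * Real.pi) :
    (fun N : ℕ => angularVariance N (-(α / 2)) (α / 2) - √(N : ℝ) * (1 / Real.pi ^ (3 / 2 : ℝ)))
      =O[atTop] fun N : ℕ => Real.log (N : ℝ) := by
  have hpi := Real.pi_pos
  have hc : 0 < 1 / Real.pi ^ (3 / 2 : ℝ) := by positivity
  set c := 1 / Real.pi ^ (3 / 2 : ℝ) with hc_def
  have hx : α / (2 * Real.pi) < 1 := by rw [div_lt_one (by positivity)]; exact h1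
  have hx0 : 0 < α / (2 * Real.pi) := by positivity
  have hE := angularVariance_sub_Iarg_isBigO (δ := 1 - α / (2 * Real.pi)) (by linarith)
    (by linarith) (α := fun _ => α) (.of_forall fun _ => h0.le)
    (.of_forall fun _ => le_of_eq (by field_simp; ring))
  have hI : (fun N : ℕ => √(N : ℝ) * c * (Iarg (√(N : ℝ) * α) - 1)) =O[atTop]
      fun N : ℕ => Real.log (N : ℝ) := by
    refine IsBigO.trans (IsBigO.of_bound (c / α) ?_) one_add_log_isBigO
    filter_upwards [eventually_ne_atTop 0] with N hN
    have hs : 0 < √(N : ℝ) := Real.sqrt_pos.2 (by positivity)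
    have hlog := Real.log_natCast_nonneg N
    rw [Real.norm_of_nonneg (by linarith : 0 ≤ 1 + Real.log (N : ℝ)), norm_mul,
      Real.norm_of_nonneg (by positivity), Real.norm_eq_abs]
    calc √(N : ℝ) * c * |Iarg (√(N : ℝ) * α) - 1| ≤ √(N : ℝ) * c * (1 / (√(N : ℝ) * α)) := by
          gcongr
          exact abs_Iarg_sub_one_le (by positivity)
      _ = c / α * 1 := by field_simp
      _ ≤ _ := by gcongr; linarith
  refine (hE.add hI).congr_left fun N => ?_
  ring

theorem isLittleO_sqrt_mul {f g : ℕ → ℝ} {c r : ℝ} (hc : c ≠ 0) (hr : r ≠ 0)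
    (hf : f =O[atTop] fun N : ℕ => Real.log (N : ℝ)) (hg : Tendsto g atTop (𝓝 0)) :
    (fun N : ℕ => f N + √(N : ℝ) * c * g N) =o[atTop] fun N : ℕ => √(N : ℝ) * c * r := by
  have h1 : (fun N : ℕ => √(N : ℝ)) =O[atTop] fun N : ℕ => √(N : ℝ) * c * r := by
    simp_rw [mul_assoc]
    refine IsBigO.of_bound (‖c * r‖⁻¹) (.of_forall fun N => ?_)
    have : ‖c * r‖ ≠ 0 := by simpa using ⟨hc, hr⟩
    rw [mul_comm √(N : ℝ), norm_mul (c * r), inv_mul_cancel_left₀ this]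
  have h2 : (fun N : ℕ => √(N : ℝ) * c * g N) =o[atTop] fun N : ℕ => √(N : ℝ) := by
    have h3 : (fun N : ℕ => c * g N) =o[atTop] fun _ : ℕ => (1 : ℝ) :=
      ((isLittleO_one_iff ℝ).2 hg).const_mul_left c
    have := (isBigO_refl (fun N : ℕ => √(N : ℝ)) atTop).mul_isLittleO h3
    refine this.congr (fun N => by ring) fun N => by ring
  exact ((hf.trans_isLittleO log_isLittleO_sqrt).add h2).trans_isBigO h1

theorem tendsto_Iarg_atTop : Tendsto Iarg atTop (𝓝 1) := by
  rw [tendsto_iff_norm_sub_tendsto_zero]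
  refine squeeze_zero' (.of_forall fun _ => norm_nonneg _) ?_
    (tendsto_const_nhds.div_atTop tendsto_id : Tendsto (fun β : ℝ => 1 / β) atTop (𝓝 0))
  filter_upwards [eventually_gt_atTop 0] with β hβ using abs_Iarg_sub_one_le hβ

theorem tendsto_Iarg_comp {ι : Type*} {l : Filter ι} {u : ι → ℝ} {β : ℝ} (hβ : 0 ≤ β)
    (hu0 : ∀ᶠ i in l, 0 ≤ u i) (hu : Tendsto u l (𝓝 β)) :
    Tendsto (fun i => Iarg (u i)) l (𝓝 (Iarg β)) := by
  rw [tendsto_iff_norm_sub_tendsto_zero]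
  have hlim : Tendsto (fun x => √Real.pi / 2 * |x - β|) (𝓝 β) (𝓝 0) := by
    have : Continuous fun x => √Real.pi / 2 * |x - β| := by fun_prop
    simpa using this.tendsto β
  refine squeeze_zero' (.of_forall fun _ => norm_nonneg _) ?_ (hlim.comp hu)
  filter_upwards [hu0] with i hi using abs_Iarg_sub_le hi hβ

theorem tendsto_Iarg_nhdsGT_zero : Tendsto Iarg (𝓝[>] 0) (𝓝 0) := by
  have h := tendsto_Iarg_comp (l := 𝓝[>] (0 : ℝ)) (u := id) le_rfl
    (eventually_mem_nhdsWithin.mono fun x hx => le_of_lt hx)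
    (tendsto_id.mono_left nhdsWithin_le_nhds)
  rwa [Iarg_zero] at h

/-- Covers arcs with `√N α → ∞` (`r = 1`) and with `√N α → β > 0` (`r = Iarg β`). -/
theorem angularVariance_isEquivalent {α : ℕ → ℝ} {r : ℝ} (hr : r ≠ 0)
    (h0 : ∀ᶠ N in atTop, 0 ≤ α N) (h1 : ∀ᶠ N in atTop, α N ≤ Real.pi)
    (h : Tendsto (fun N : ℕ => Iarg (√(N : ℝ) * α N)) atTop (𝓝 r)) :
    (fun N : ℕ => angularVariance N (-(α N / 2)) (α N / 2))
      ~[atTop] fun N : ℕ => √(N : ℝ) * (1 / Real.pi ^ (3 / 2 : ℝ)) * r := by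
  have hpi := Real.pi_pos
  have hE := angularVariance_sub_Iarg_isBigO (δ := 1 / 2) (by norm_num) (by norm_num) h0
    (h1.mono fun N hN => by linarith)
  have hc : (1 / Real.pi ^ (3 / 2 : ℝ)) ≠ 0 := by positivity
  have := isLittleO_sqrt_mul hc hr hE (tendsto_sub_nhds_zero_iff.2 h)
  refine this.congr_left fun N => ?_
  simp only [Pi.sub_apply]
  ring

theorem angularVariance_narrow_arc {α : ℕ → ℝ} (h0 : ∀ᶠ N in atTop, 0 ≤ α N)
    (hα : Tendsto α atTop (𝓝 0))
    (h : Tendsto (fun N : ℕ => √(N : ℝ) * α N) atTop (𝓝 0)) :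
    (fun N : ℕ => angularVariance N (-(α N / 2)) (α N / 2))
      ~[atTop] fun N : ℕ => (N : ℝ) * α N / (2 * Real.pi) := by
  have hpi := Real.pi_pos
  have hlim : Tendsto (fun N : ℕ => α N + 6 * (√(N : ℝ) * α N)) atTop (𝓝 0) := by
    simpa using hα.add (h.const_mul 6)
  refine isLittleO_iff.2 fun ε hε => ?_
  filter_upwards [h0, hα.eventually_le_const (by positivity : (0 : ℝ) < 2 * Real.pi),
    hlim.eventually_le_const hε] with N hN0 hN1 hN2
  have := abs_angularVariance_sub_mean_le N hN0 hN1
  have hm : 0 ≤ (N : ℝ) * α N / (2 * Real.pi) := by positivity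
  rw [Real.norm_of_nonneg hm, mul_comm ε]
  exact this.trans (by gcongr)

theorem angularVariance_sub_Iarg_limit_isBigO {α : ℕ → ℝ} {β : ℝ} (hβ : 0 ≤ β)
    (h0 : ∀ᶠ N in atTop, 0 ≤ α N) (h1 : ∀ᶠ N in atTop, α N ≤ Real.pi)
    (h : (fun N : ℕ => √(N : ℝ) * α N - β) =O[atTop]
      (fun N : ℕ => Real.log (N : ℝ) / √(N : ℝ))) :
    (fun N : ℕ => angularVariance N (-(α N / 2)) (α N / 2) -
      √(N : ℝ) * (1 / Real.pi ^ (3 / 2 : ℝ)) * Iarg β) =O[atTop] fun N : ℕ => Real.log (N : ℝ) := by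
  have hpi := Real.pi_pos
  set c := 1 / Real.pi ^ (3 / 2 : ℝ) with hc
  have hE := angularVariance_sub_Iarg_isBigO (δ := 1 / 2) (by norm_num) (by norm_num) h0
    (h1.mono fun N hN => by linarith)
  have hLip : (fun N : ℕ => Iarg (√(N : ℝ) * α N) - Iarg β) =O[atTop]
      fun N : ℕ => √(N : ℝ) * α N - β := by
    refine IsBigO.of_bound (√Real.pi / 2) ?_
    filter_upwards [h0] with N hN using abs_Iarg_sub_le (by positivity) hβ
  have hI : (fun N : ℕ => √(N : ℝ) * c * (Iarg (√(N : ℝ) * α N) - Iarg β)) =O[atTop]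
      fun N : ℕ => Real.log (N : ℝ) := by
    have := ((isBigO_refl (fun N : ℕ => √(N : ℝ)) atTop).mul (hLip.trans h)).const_mul_left c
    refine this.congr' (.of_forall fun N => by ring) ?_
    filter_upwards [eventually_ne_atTop 0] with N hN
    have hs : 0 < √(N : ℝ) := Real.sqrt_pos.2 (by positivity)
    field_simp
  refine (hE.add hI).congr_left fun N => ?_
  ring

end Ginibre

theorem theorem5 :
    -- rotation invariance: only the length of the interval of arguments matters
    (∀ (N : ℕ) (a b : ℝ), -Real.pi ≤ a → a ≤ b → b ≤ Real.pi →
      Ginibre.angularVariance N a b =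
        Ginibre.angularVariance N (-((b - a) / 2)) ((b - a) / 2)) ∧
    -- fixed arcs
    (∀ α : ℝ, 0 < α → α < 2 * Real.pi →
      (fun N : ℕ => Ginibre.angularVariance N (-(α / 2)) (α / 2)
          - √(N : ℝ) * (1 / Real.pi ^ (3 / 2 : ℝ)))
        =O[atTop] fun N : ℕ => Real.log (N : ℝ)) ∧
    -- shrinking arcs
    (∀ α : ℕ → ℝ, Tendsto α atTop (𝓝[>] 0) →
      Tendsto (fun N : ℕ => (N : ℝ) * α N) atTop atTop →
      (Tendsto (fun N : ℕ => √(N : ℝ) * α N) atTop atTop →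
        (fun N : ℕ => Ginibre.angularVariance N (-(α N / 2)) (α N / 2))
          ~[atTop] fun N : ℕ => √(N : ℝ) * (1 / Real.pi ^ (3 / 2 : ℝ))) ∧
      (∀ β : ℝ, 0 < β → Tendsto (fun N : ℕ => √(N : ℝ) * α N) atTop (𝓝 β) →
        ((fun N : ℕ => Ginibre.angularVariance N (-(α N / 2)) (α N / 2)
            - √(N : ℝ) * (1 / Real.pi ^ (3 / 2 : ℝ)) * Ginibre.Iarg (√(N : ℝ) * α N))
          =O[atTop] fun N : ℕ => Real.log (N : ℝ)) ∧
        ((fun N : ℕ => Ginibre.angularVariance N (-(α N / 2)) (α N / 2))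
          ~[atTop] fun N : ℕ => √(N : ℝ) * (1 / Real.pi ^ (3 / 2 : ℝ)) * Ginibre.Iarg β) ∧
        ((fun N : ℕ => √(N : ℝ) * α N - β)
            =O[atTop] (fun N : ℕ => Real.log (N : ℝ) / √(N : ℝ)) →
          (fun N : ℕ => Ginibre.angularVariance N (-(α N / 2)) (α N / 2)
              - √(N : ℝ) * (1 / Real.pi ^ (3 / 2 : ℝ)) * Ginibre.Iarg β)
            =O[atTop] fun N : ℕ => Real.log (N : ℝ))) ∧
      (Tendsto (fun N : ℕ => √(N : ℝ) * α N) atTop (𝓝 0) →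
        (fun N : ℕ => Ginibre.angularVariance N (-(α N / 2)) (α N / 2))
          ~[atTop] fun N : ℕ => (N : ℝ) * α N / (2 * Real.pi))) ∧
    -- properties of the crossover function
    (∀ β : ℝ, 0 < β → 0 ≤ Ginibre.Iarg β) ∧
    Tendsto Ginibre.Iarg (𝓝[>] 0) (𝓝 0) ∧
    Tendsto Ginibre.Iarg atTop (𝓝 1) := by
  have hpi := Real.pi_pos
  refine ⟨fun N a b ha hab hb => ?_, fun α h0 h1 => Ginibre.angularVariance_fixed_arc h0 h1,
    fun α hα _ => ?_, fun β hβ => (Ginibre.Iarg_pos hβ).le, Ginibre.tendsto_Iarg_nhdsGT_zero,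
    Ginibre.tendsto_Iarg_atTop⟩
  · exact Ginibre.angularVariance_congr N ha hab hb (by linarith) (by linarith) (by linarith)
      (by ring)
  have hα0 : Tendsto α atTop (𝓝 0) := hα.mono_right nhdsWithin_le_nhds
  have h0 : ∀ᶠ N in atTop, 0 ≤ α N :=
    (hα.eventually eventually_mem_nhdsWithin).mono fun N hN => le_of_lt hN
  have h1 : ∀ᶠ N in atTop, α N ≤ Real.pi := hα0.eventually_le_const hpi
  refine ⟨fun h => ?_, fun β hβ h => ⟨?_, ?_, fun hrate => ?_⟩, fun h =>
    Ginibre.angularVariance_narrow_arc h0 hα0 h⟩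
  · simpa using Ginibre.angularVariance_isEquivalent one_ne_zero h0 h1
      (Ginibre.tendsto_Iarg_atTop.comp h)
  · exact Ginibre.angularVariance_sub_Iarg_isBigO (δ := 1 / 2) (by norm_num) (by norm_num) h0
      (h1.mono fun N hN => by linarith)
  · exact Ginibre.angularVariance_isEquivalent (Ginibre.Iarg_pos hβ).ne' h0 h1
      (Ginibre.tendsto_Iarg_comp hβ.le (h0.mono fun N hN => by positivity) h)
  · exact Ginibre.angularVariance_sub_Iarg_limit_isBigO hβ.le h0 h1 hrate
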